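/- **Setting.** $\log$ is base 2, and $\varepsilon_i=2^{-i}$ for every integer $i$. $\Delta_{\rm edit}(u,v)$ is the edit distance (minimum number of character insertions, deletions, substitutions). Let $n$ be a power of 2, $\theta\in(0,1]$ a power of $1/2$, $L=\log(1/\theta)$, $x,y$ strings of length $n$, and $z=xy$. An interval is a set of consecutive integers $I=\{\min I,\dots,\max I\}$, its width is $\mu(I)=\max I-\min I$, and $z_I$ is the string of the characters of $z$ (numbered from 1) with index in $I\setminus\{\min I\}$. $\mathcal I(w)$ is the set of intervals $I\subseteq\{0,\dots,n\}$ of width $w$ with $w\mid\min I$; $\mathcal I(w,\delta)$ is the set of intervals $J\subseteq\{0,\dots,2n\}$ of width $w$ with $\min J$ a multiple of $\max(\delta w,1)$; $\mathcal I(w;I)=\{I'\in\mathcal I(w):I'\subseteq I\}$. In the grid $\{0,\dots,n\}\times\{0,\dots,2n\}$, unit horizontal and vertical edges cost 1, and the diagonal edge into $(a,b)$ costs 0 if $z_a=z_b$ and 1 otherwise. $\mathrm{cost}(I\times J)$ is the minimum cost of a monotone path from $(\min I,\min J)$ to $(\max I,\max J)$, and $\mathrm{ncost}(I\times J)=\mathrm{cost}(I\times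 J)/\mu(I)$. **Subroutine.** $\mathrm{ED}$ is a randomized algorithm which on input $(m,\theta',\delta;u,v)$ answers ACCEPT or REJECT. For constants $\zeta'\ge0$, $Q'\ge1$ assume: for all powers $m$ of 2, all powers $\theta'\le 1$ of $1/2$ with $\theta'\ge m^{-\zeta'}$, all $\delta\in(0,1)$ and all $u,v$ of length $m$, it always rejects if $\Delta_{\rm edit}(u,v)>Q'\theta'm$, and accepts with probability at least $1-\delta$ if $\Delta_{\rm edit}(u,v)\le\theta'm$. (Its running time plays no role.) In a run, all calls use $\delta=n^{-12}$ and one common random seed; $\mathrm{ED}(I,J,i)$ denotes the call with $m=\mu(I)$, $\theta'=\varepsilon_i$, $u=z_I$, $v=z_J$. **Parameters.** Powers of 2, $w_1<\dots<w_{k+1}=n$ and $d_0>\dots>d_k=1$, where $w_1=d_0$ is the largest power of 2 that is at most $\sqrt n$, with $d_j\le n/w_j$ and $w_j/w_{j+1}\le\theta/2$ for $1\le j\le k$; $c_0=\lceil\log Q'\rceil$, $c_j=3c_{j-1}+21$; a constant $a>0$, and $p_j=\min(1,a\log n/d_j)$. **Primitives.** A weighted box $(I\times J,\kappa)$ is *certified*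 if $\mathrm{ncost}(I\times J)\le\kappa$. A set $R$ of weighted boxes defines a graph with all horizontal and vertical unit edges, of cost 1, and for each $(I\times J,\kappa)\in R$ an edge from $(\min I,\min J)$ to $(\max I,\max J)$ of cost $\kappa\mu(I)$. $\mathrm{APM}(I\times\mathcal J,\kappa,R)$ is the set of $J\in\mathcal J$ such that, after adding edges of cost 0 from $(\min I,0)$ to $(\min I,\min J')$ for all $J'\in\mathcal J$, the cheapest path from $(\min I,0)$ to $(\max I,\max J)$ costs at most $\kappa\mu(I)$. $\mathrm{Round}(J,\delta)$ shifts $J$ down to the nearest interval whose minimum is a multiple of $\max(\delta\mu(J),1)$. $\mathrm{ZoomIn}(I\times J,i,I',i')$ is the set of $J'\in\mathcal I(\mu(I'),\varepsilon_{i'+3})$ with $J'\subseteq J$ and $|(\min J'-\min J)-(\min I'-\min I)|\le2\varepsilon_i\mu(I)$. $\mathrm{INDUCED}(\mathcal Q)$ consists of all $(I\times J,\kappa)\in\mathcal Q$ and all $(I\times\{\min J+2^s,\dots,\max J-2^s\},\,\kappa+2^{s+1}/\mu(I))$, $0\le s<\log\mu(J)$. **The algorithm MAIN** performs, for $j=1,\dots,k$,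 Preprocess$(j)$ and then ProcessDense$(j)$. Indices $i$ range over $\{0,\dots,L\}$, and $I$ over $\mathcal I(w_j)$. *Preprocess$(j)$.* Write $\mathcal S(j,I,i)=\mathcal I(w_{j-1};I)\cap\mathrm{Sparse}(j-1,i)$. If $j=1$, all $\mathrm{Bbelow}(1,I,i)$ and $\mathrm{SparseSample}(1,I,i)$ are empty. If $j\ge2$: $\mathrm{SparseSample}(j,I,i)$ consists of $30\log n$ independent uniform selections from $\mathcal S(j,I,i)$ (none if this set is empty), and $\mathrm{Bbelow}(j,I,i)=\mathrm{APM}(I\times\mathcal I(w_j,\varepsilon_{i+3}),\varepsilon_{i-c_{j-1}-5},R(j-1,I))$, where $R(j-1,I)$ is the set of boxes $(I'\times J',\kappa)\in R(j-1)$ with $I'\subseteq I$. *Enumerate$(j,I\times\mathcal J,i)$*, for $\mathcal J\subseteq\mathcal I(w_j,\varepsilon_{i+3})$. For $j=1$ it returns $\{J\in\mathcal J:\mathrm{ED}(I,J,i)\text{ accepts}\}$. For $j\ge2$ put $\mathcal S_0=\mathrm{Bbelow}(j,I,i)\cap\mathcal J$ and $\mathcal J_1=\mathcal J\setminus\mathcal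 S_0$; let $\mathcal K$ be the set of $J\in\mathcal J_1$ such that for some $i'\le i$ and $I'\in\mathrm{SparseSample}(j,I,i')$ the set $\mathrm{ZoomIn}(I\times J,i,I',i')$ meets $\mathrm{Enumerate}(j-1,I'\times\mathcal J',i')$, where $\mathcal J'=\bigcup_{J_1\in\mathcal J_1}\mathrm{ZoomIn}(I\times J_1,i,I',i')$. It returns $\mathcal S_0\cup\{J\in\mathcal K:\mathrm{ED}(I,J,i)\text{ accepts}\}$. The candidate $(i;I\times J)$ of level $j$ is CLOSE if $\mathrm{Enumerate}(j,I\times\{J\},i)=\{J\}$ and FAR if it is $\emptyset$. *ProcessDense$(j)$.* For each $i\le c_j$: $\mathrm{Sparse}(j,i)=\emptyset$ and $\mathrm{Bdense}(j,I,i)=\mathcal I(w_j,\varepsilon_{i+3})$ for all $I$. For each $i>c_j$: start with $\mathcal T=\mathcal I(w_j)$, $\mathrm{Sparse}(j,i)=\emptyset$ and all $\mathrm{Bdense}(j,I,i)$ empty; while $\mathcal T\ne\emptyset$, pick any $I\in\mathcal T$ and a random $S\subseteq\mathcal I(w_j,\varepsilon_{i+3})$ containing each element independently with probability $p_j$. If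 $|\mathrm{Enumerate}(j,I\times S,i)|<p_jd_j$, then put $I$ into $\mathrm{Sparse}(j,i)$ and remove it from $\mathcal T$. Otherwise $I$ is a *pivot*: with $h_1=i-c_{j-1}-7$ and $h_2=i-2c_{j-1}-14$ let $\mathcal X=\mathrm{Enumerate}(j,I\times\mathcal I(w_j),h_1)$ and $\mathcal Y=\{J\in\mathcal I(w_j,\varepsilon_{i+3}):\mathrm{Round}(J,\varepsilon_{h_2+3})\in\mathrm{Enumerate}(j,I\times\mathcal I(w_j,\varepsilon_{h_2+3}),h_2)\}$, set $\mathrm{Bdense}(j,I',i)=\mathcal Y$ for all $I'\in\mathcal X$, and remove $\mathcal X$ from $\mathcal T$. Finally $\mathcal Q(j)=\{(I\times J,\varepsilon_{i-c_j}):0\le i\le L,\ I\in\mathcal I(w_j),\ J\in\mathrm{Bdense}(j,I,i)\}$ and $R(j)=\mathrm{INDUCED}(\mathcal Q(j))$. For $j\ge2$, $J\in\mathcal I(w_j,\varepsilon_{i+3})$ and $i'\le i$, $\mathrm{winners}(j,I\times J,i,i')$ is the set of $I'\in\mathcal S(j,I,i')$ for which some $J'\in\mathrm{ZoomIn}(I\times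 J,i,I',i')$ has $(i';I'\times J')$ CLOSE at level $j-1$. **Successful randomization** means, for all levels $j\le k$, all $i\in\{0,\dots,L\}$, $I\in\mathcal I(w_j)$ and $J\in\mathcal I(w_j,\varepsilon_{i+3})$: - the call $\mathrm{ED}(I,J,i)$ is correct: it accepts if $\Delta_{\rm edit}(z_I,z_J)\le\varepsilon_iw_j$ and rejects if $\Delta_{\rm edit}(z_I,z_J)>Q'\varepsilon_iw_j$ (the latter is part of the assumption on $\mathrm{ED}$ when $\varepsilon_i\ge w_j^{-\zeta'}$); - if $j\ge2$, $i'\le i$, $\mathcal S(j,I,i')\neq\emptyset$ and $|\mathrm{winners}(j,I\times J,i,i')|\ge\frac13|\mathcal S(j,I,i')|$, then $\mathrm{SparseSample}(j,I,i')$ contains an element of $\mathrm{winners}(j,I\times J,i,i')$; - $|\mathrm{Enumerate}(j,I\times\mathcal I(w_j,\varepsilon_{i+3}),i)|$ is at least $d_j/2$ if $I$ was used as a pivot for $(j,i)$, and at most $2d_j$ if $I\in\mathrm{Sparse}(j,i)$. **Theorem.** Suppose $n^{-\zeta'}\le\theta\le1$, and consider a (terminating) run of MAIN on $(n,\theta;x,y)$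 with successful randomization. Then for all $j\in\{1,\dots,k\}$, $i\in\{0,\dots,L\}$, $I\in\mathcal I(w_j)$, $J\in\mathcal I(w_j,\varepsilon_{i+3})$ and $\mathcal J\subseteq\mathcal I(w_j,\varepsilon_{i+3})$: 1. (Soundness of Bbelow) If $J\in\mathrm{Bbelow}(j,I,i)$, then $\mathrm{ncost}(I\times J)\le\varepsilon_{i-c_{j-1}-6}$. 2. (Completeness of Bbelow) If $j\ge2$ and $\mathrm{ncost}(I\times J)\le\varepsilon_i$, then $J\in\mathrm{Bbelow}(j,I,i)$, or there is $i'\le i$ with $|\mathrm{winners}(j,I\times J,i,i')|>\frac13|\mathcal I(w_{j-1};I)\cap\mathrm{Sparse}(j-1,i')|$. 3. (Consistency of Enumerate) $J\in\mathrm{Enumerate}(j,I\times\mathcal J,i)$ if and only if $J\in\mathcal J$ and $J\in\mathrm{Enumerate}(j,I\times\{J\},i)$. Moreover $(i;I\times J)$ is CLOSE if $J\in\mathrm{Enumerate}(j,I\times\{J\},i)$ and FAR otherwise, and not both. 4. (Soundness of Enumerate) If $(i;I\times J)$ is CLOSE, then $\mathrm{ncost}(I\times J)\le\varepsilon_{i-c_{j-1}-6}$.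 5. (Completeness of Enumerate) If $\mathrm{ncost}(I\times J)\le\varepsilon_i$, then $(i;I\times J)$ is CLOSE. 6. (Validity of Sparse) If $I\in\mathrm{Sparse}(j,i)$, then $|\mathrm{Enumerate}(j,I\times\mathcal I(w_j,\varepsilon_{i+3}),i)|\le2d_j$. 7. (Soundness of Bdense) If $J\in\mathrm{Bdense}(j,I,i)$, then $\mathrm{ncost}(I\times J)\le\varepsilon_{i-c_j}$. 8. (Completeness of Bdense) If $I\notin\mathrm{Sparse}(j,i)$ and $\mathrm{ncost}(I\times J)\le\varepsilon_i$, then $J\in\mathrm{Bdense}(j,I,i)$. 9. (Soundness of $R(j)$) Every weighted box in $R(j)$ is certified. 10. (Completeness of $\mathcal Q(j)$) If $I\notin\mathrm{Sparse}(j,i)$ and $\mathrm{ncost}(I\times J)\le\varepsilon_i$, then $(I\times J,\varepsilon_{i-c_j})\in\mathcal Q(j)$; if moreover $c_j\le L$, then also $(I\times J,\min(1,\varepsilon_{i-c_j}))\in\mathcal Q(j)$. -/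

import Mathlib

namespace EditDist

/-! ### Strings and edit distance -/

/-- One character insertion, deletion or substitution. -/
inductive EditStep {α : Type*} : List α → List α → Prop
  | insert (p s : List α) (a : α) : EditStep (p ++ s) (p ++ a :: s)
  | delete (p s : List α) (a : α) : EditStep (p ++ a :: s) (p ++ s)
  | subst (p s : List α) (a b : α) : EditStep (p ++ a :: s) (p ++ b :: s)

/-- `EditsIn k u v`: the string `u` can be converted into `v` by exactly `k` edit operations. -/
inductive EditsIn {α : Type*} : ℕ → List α → List α → Prop
  | refl (u : List α) : EditsIn 0 u u
  | step {k : ℕ} {u v t : List α} : EditsIn k u v → EditStep v t → EditsIn (k + 1) u t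

/-- The edit (Levenshtein) distance. -/
noncomputable def editd {α : Type*} (u v : List α) : ℕ := sInf {k | EditsIn k u v}

/-! ### Gap algorithms -/

/-- A randomized algorithm with random seed `ω : Ω`, input parameters `(m, θ, δ)` and two input
strings; the value `true` means ACCEPT and `false` means REJECT. -/
abbrev GapAlgorithm (Ω α : Type*) := Ω → ℕ → ℝ → ℝ → List α → List α → Bool

/-- The correctness part of the gap condition: the algorithm has quality `Q` with respect to all
`(m, θ, δ)` with `m` a power of two, `θ` a nonnegative power of `1/2` with `θ ≥ m ^ (-ζ)`, and
`0 < δ < 1`.  (No bound on the running time is required.) -/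
def GapCondition {Ω α : Type*} [MeasurableSpace Ω] (pr : MeasureTheory.Measure Ω)
    (ED : GapAlgorithm Ω α) (ζ Q : ℝ) : Prop :=
  0 ≤ ζ ∧ 1 ≤ Q ∧
  ∀ m : ℕ, (∃ a : ℕ, m = 2 ^ a) → ∀ θ : ℝ, (∃ b : ℕ, θ = (1 / 2 : ℝ) ^ b) →
    (m : ℝ) ^ (-ζ) ≤ θ → ∀ δ : ℝ, 0 < δ → δ < 1 →
    ∀ u v : List α, u.length = m → v.length = m →
      (Q * θ * m < editd u v → ∀ ω, ED ω m θ δ u v = false) ∧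
      ((editd u v : ℝ) ≤ θ * m → ENNReal.ofReal (1 - δ) ≤ pr {ω | ED ω m θ δ u v = true})

/-! ### Intervals, boxes and the grid graph -/

/-- The interval `{lo, …, lo + width}` of natural numbers. -/
structure Ivl where
  lo : ℕ
  width : ℕ
deriving DecidableEq

/-- The largest element of an interval. -/
def Ivl.hi (I : Ivl) : ℕ := I.lo + I.width

/-- Containment of intervals (as sets). -/
def Ivl.Sub (I' I : Ivl) : Prop := I.lo ≤ I'.lo ∧ I'.hi ≤ I.hi

/-- The substring `z_{lo+1} ⋯ z_{hi}` (characters of `z` numbered from 1) indexed by `I`. -/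
def substr {α : Type*} (z : List α) (I : Ivl) : List α := (z.drop I.lo).take I.width

/-- `ε_i = 2^{-i}`, for every integer `i`. -/
noncomputable def eps (i : ℤ) : ℝ := (2 : ℝ) ^ (-i)

/-- The set of aligned intervals of width `w` contained in `{0, …, n}`. -/
def alignedIvls (n w : ℕ) : Finset Ivl :=
  ((Finset.range (n + 1)).image fun a => Ivl.mk a w).filter fun I => w ∣ I.lo ∧ I.hi ≤ n

/-- For a power of two `w`, this is `max (ε_s * w) 1`. -/
def alignStep (w s : ℕ) : ℕ := max (w / 2 ^ s) 1

/-- The set of `ε_s`-aligned intervals of width `w` contained in `{0, …, 2n}`. -/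
def epsAlignedIvls (n w s : ℕ) : Finset Ivl :=
  ((Finset.range (2 * n + 1)).image fun a => Ivl.mk a w).filter fun J =>
    alignStep w s ∣ J.lo ∧ J.hi ≤ 2 * n

open Classical in
/-- The aligned intervals of width `w` contained in `I`. -/
noncomputable def alignedIvlsIn (n w : ℕ) (I : Ivl) : Finset Ivl :=
  (alignedIvls n w).filter fun I' => I'.Sub I

open Classical in
/-- Directed paths of the grid graph of `z`, with their cost.  Horizontal and vertical edges cost
1; the diagonal edge into `(i+1, j+1)` compares the `(i+1)`-st and `(j+1)`-st characters. -/
inductive GridPath {α : Type*} (z : List α) : ℕ × ℕ → ℕ × ℕ → ℕ → Prop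
  | nil (p : ℕ × ℕ) : GridPath z p p 0
  | horiz {p : ℕ × ℕ} {i j c : ℕ} : GridPath z p (i, j) c → GridPath z p (i + 1, j) (c + 1)
  | vert {p : ℕ × ℕ} {i j c : ℕ} : GridPath z p (i, j) c → GridPath z p (i, j + 1) (c + 1)
  | diag {p : ℕ × ℕ} {i j c : ℕ} : GridPath z p (i, j) c →
      GridPath z p (i + 1, j + 1) (c + if z[i]? = z[j]? then 0 else 1)

/-- The cost of the box `I × J`: the minimum cost of a traversal. -/
noncomputable def cost {α : Type*} (z : List α) (I J : Ivl) : ℕ :=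
  sInf {c | GridPath z (I.lo, J.lo) (I.hi, J.hi) c}

/-- The normalized cost of the box `I × J`. -/
noncomputable def ncost {α : Type*} (z : List α) (I J : Ivl) : ℝ := (cost z I J : ℝ) / I.width

/-! ### Weighted boxes, shortcut graphs and the elementary primitives -/

/-- A weighted box `(I × J, κ)`. -/
structure WBox where
  I : Ivl
  J : Ivl
  κ : ℝ

/-- A weighted box is certified if its weight is at least the normalized cost of the box. -/
def WBox.Certified {α : Type*} (z : List α) (b : WBox) : Prop := ncost z b.I b.J ≤ b.κ

/-- A weighted edge of the plane grid. -/
structure WEdge where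
  src : ℕ × ℕ
  tgt : ℕ × ℕ
  wt : ℝ

/-- The shortcut edges associated with a set of weighted boxes. -/
def shortcutEdges (R : Set WBox) : Set WEdge :=
  {e | ∃ b ∈ R, e = ⟨(b.I.lo, b.J.lo), (b.I.hi, b.J.hi), b.κ * b.I.width⟩}

/-- Paths, with their cost, in the graph consisting of all horizontal and vertical edges (of
cost 1) together with the weighted edges in `E`. -/
inductive ShortcutPath (E : Set WEdge) : ℕ × ℕ → ℕ × ℕ → ℝ → Prop
  | nil (p : ℕ × ℕ) : ShortcutPath E p p 0
  | horiz {p : ℕ × ℕ} {i j : ℕ} {c : ℝ} :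
      ShortcutPath E p (i, j) c → ShortcutPath E p (i + 1, j) (c + 1)
  | vert {p : ℕ × ℕ} {i j : ℕ} {c : ℝ} :
      ShortcutPath E p (i, j) c → ShortcutPath E p (i, j + 1) (c + 1)
  | shortcut {p : ℕ × ℕ} {c : ℝ} (e : WEdge) (he : e ∈ E) :
      ShortcutPath E p e.src c → ShortcutPath E p e.tgt (c + e.wt)

/-- The minimum cost of a path from `p` to `q`. -/
noncomputable def shortcutCost (E : Set WEdge) (p q : ℕ × ℕ) : ℝ :=
  sInf {c | ShortcutPath E p q c}

open Classical in
/-- Approximate pattern match: the shortcut graph of `R` is augmented by edges of cost 0 from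
`(min I, 0)` to `(min I, min J)` for all `J ∈ Js`, and those `J ∈ Js` are returned for which
`I × {0, …, max J}` has a traversal of cost at most `κ * μ(I)` in the augmented graph. -/
noncomputable def APM (I : Ivl) (Js : Finset Ivl) (κ : ℝ) (R : Set WBox) : Finset Ivl :=
  Js.filter fun J =>
    shortcutCost (shortcutEdges R ∪ {e | ∃ J' ∈ Js, e = ⟨(I.lo, 0), (I.lo, J'.lo), 0⟩})
      (I.lo, 0) (I.hi, J.hi) ≤ κ * I.width

/-- Shift `J` down to the nearest `ε_s`-aligned interval of the same width. -/
def roundDown (J : Ivl) (s : ℕ) : Ivl :=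
  ⟨J.lo / alignStep J.width s * alignStep J.width s, J.width⟩

/-- `J/[t]`: the interval `{min J + t, …, max J - t}` (used for `2 * t ≤ μ(J)`). -/
def Ivl.shrink (J : Ivl) (t : ℕ) : Ivl := ⟨J.lo + t, J.width - 2 * t⟩

/-- The weighted boxes induced by a set of weighted square boxes. -/
def induced (Q : Set WBox) : Set WBox :=
  {b | b ∈ Q ∨ ∃ a ∈ Q, ∃ s < Nat.log 2 a.J.width,
    b = ⟨a.I, a.J.shrink (2 ^ s), a.κ + 2 ^ (s + 1) / a.I.width⟩}

/-- The displacement of the square box `I' × J'` with respect to the square box `I × J`: the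
vertical distance between the lines containing their diagonals. -/
def boxDisplacement (I' J' I J : Ivl) : ℤ :=
  |((J'.lo : ℤ) - J.lo) - ((I'.lo : ℤ) - I.lo)|

open Classical in
/-- `ZoomIn(I × J, i, I', i')`: the `ε_{i'+3}`-aligned intervals `J' ⊆ J` of width `μ(I')` for
which `I' × J'` has displacement at most `2 ε_i μ(I)` from `I × J`. -/
noncomputable def zoomIn (n : ℕ) (I J : Ivl) (i : ℕ) (I' : Ivl) (i' : ℕ) : Finset Ivl :=
  (epsAlignedIvls n I'.width (i' + 3)).filter fun J' =>
    J'.Sub J ∧ (boxDisplacement I' J' I J : ℝ) ≤ 2 * eps i * I.width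

/-! ### Parameters of the algorithm -/

/-- The parameters: the length `n`, `L = log (1/θ)`, the number `k` of levels, the widths `w_j`,
the densities `d_j`, the quality `Q` of the subroutine, and the sampling constant. -/
structure Params where
  n : ℕ
  L : ℕ
  k : ℕ
  w : ℕ → ℕ
  d : ℕ → ℕ
  Q : ℝ
  sampleConst : ℝ

/-- The gap parameter `θ = 2^{-L}`. -/
noncomputable def Params.θ (P : Params) : ℝ := (1 / 2 : ℝ) ^ P.L

/-- The quality parameters: `c_0 = log Q` (rounded up when `Q` is not a power of two) and
`c_j = 3 c_{j-1} + 21`. -/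
noncomputable def Params.c (P : Params) : ℕ → ℕ
  | 0 => ⌈Real.logb 2 P.Q⌉₊
  | j + 1 => 3 * P.c j + 21

/-- The sampling probability `p = min (1, (const * log n) / d_j)` at level `j`. -/
noncomputable def Params.prob (P : Params) (j : ℕ) : ℝ :=
  min 1 (P.sampleConst * Real.logb 2 P.n / P.d j)

/-- The constraints imposed on the parameters. -/
structure Params.Valid (P : Params) : Prop where
  n_pow : ∃ a : ℕ, P.n = 2 ^ a
  w_pow : ∀ j, 1 ≤ j → j ≤ P.k + 1 → ∃ a : ℕ, P.w j = 2 ^ a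
  d_pow : ∀ j, j ≤ P.k → ∃ a : ℕ, P.d j = 2 ^ a
  /-- `w_1` is the largest power of two that is at most `√n`. -/
  w_one : P.w 1 = 2 ^ Nat.log 2 (Nat.sqrt P.n)
  w_lt : ∀ j, 1 ≤ j → j ≤ P.k → P.w j < P.w (j + 1)
  w_last : P.w (P.k + 1) = P.n
  d_zero : P.d 0 = 2 ^ Nat.log 2 (Nat.sqrt P.n)
  d_lt : ∀ j, j < P.k → P.d (j + 1) < P.d j
  d_last : P.d P.k = 1
  d_le : ∀ j, 1 ≤ j → j ≤ P.k → (P.d j : ℝ) ≤ (P.n : ℝ) / P.w j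
  w_ratio : ∀ j, 1 ≤ j → j ≤ P.k → (P.w j : ℝ) / P.w (j + 1) ≤ P.θ / 2
  const_pos : 0 < P.sampleConst

/-- The horizontal intervals of level `j`. -/
def Params.hIvls (P : Params) (j : ℕ) : Finset Ivl := alignedIvls P.n (P.w j)

/-- The vertical intervals of level-`j` candidates with index `i`: `ε_{i+3}`-aligned, width
`w_j`. -/
def Params.vIvls (P : Params) (j i : ℕ) : Finset Ivl := epsAlignedIvls P.n (P.w j) (i + 3)

/-! ### The algorithm -/

/-- The data produced by a run: for level `j`, interval `I` and index `i`, the sets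
`Bbelow(j,I,i)`, the multisets `SparseSample(j,I,i)`, the sets `Sparse(j,i)`, the set of intervals
used as pivots when `Sparse(j,i)` was constructed, and the sets `Bdense(j,I,i)`. -/
structure RunData where
  bbelow : ℕ → Ivl → ℕ → Finset Ivl
  sample : ℕ → Ivl → ℕ → Multiset Ivl
  sparse : ℕ → ℕ → Finset Ivl
  pivots : ℕ → ℕ → Finset Ivl
  bdense : ℕ → Ivl → ℕ → Finset Ivl

open Classical in
/-- `Enumerate(j, I × Js, i)`.  Here `acc I J i` says that the call of the gap subroutine on
`z_I, z_J` with gap parameter `ε_i` returns ACCEPT. -/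
noncomputable def enumerate (P : Params) (acc : Ivl → Ivl → ℕ → Prop) (D : RunData) :
    ℕ → Ivl → Finset Ivl → ℕ → Finset Ivl
  | 0, _, _, _ => ∅
  | 1, I, Js, i => Js.filter fun J => acc I J i
  | j + 2, I, Js, i =>
    let S := D.bbelow (j + 2) I i ∩ Js
    let Js₁ := Js \ S
    let K := Js₁.filter fun J => ∃ i' ≤ i, ∃ I' ∈ D.sample (j + 2) I i',
      (zoomIn P.n I J i I' i' ∩
        enumerate P acc D (j + 1) I' (Js₁.biUnion fun J₁ => zoomIn P.n I J₁ i I' i') i').Nonempty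
    S ∪ K.filter fun J => acc I J i

/-- The candidate `(i; I × J)` of level `j` is classified as CLOSE. -/
def IsClose (P : Params) (acc : Ivl → Ivl → ℕ → Prop) (D : RunData) (j : ℕ) (I J : Ivl) (i : ℕ) :
    Prop := enumerate P acc D j I {J} i = {J}

/-- The candidate `(i; I × J)` of level `j` is classified as FAR. -/
def IsFar (P : Params) (acc : Ivl → Ivl → ℕ → Prop) (D : RunData) (j : ℕ) (I J : Ivl) (i : ℕ) :
    Prop := enumerate P acc D j I {J} i = ∅

/-- The intervals of `Sparse(j-1,i)` contained in `I`; `I` is an interval of level `j`. -/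
noncomputable def sparseIn (P : Params) (D : RunData) (j : ℕ) (I : Ivl) (i : ℕ) : Finset Ivl :=
  alignedIvlsIn P.n (P.w (j - 1)) I ∩ D.sparse (j - 1) i

open Classical in
/-- The set of `I' ∈ Sparse(j-1,i')` with `I' ⊆ I` such that `(I',i')` is a marker for the
level-`j` candidate `(i; I × J)`. -/
noncomputable def winners (P : Params) (acc : Ivl → Ivl → ℕ → Prop) (D : RunData) (j : ℕ)
    (I J : Ivl) (i i' : ℕ) : Finset Ivl :=
  (sparseIn P D j I i').filter fun I' =>
    ∃ J' ∈ zoomIn P.n I J i I' i', IsClose P acc D (j - 1) I' J' i'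

/-- The set `Q(j)` of weighted boxes. -/
def boxesQ (P : Params) (D : RunData) (j : ℕ) : Set WBox :=
  {b | ∃ i ≤ P.L, ∃ I ∈ P.hIvls j, ∃ J ∈ D.bdense j I i, b = ⟨I, J, eps ((i : ℤ) - P.c j)⟩}

/-- The set `R(j)` of weighted boxes. -/
def boxesR (P : Params) (D : RunData) (j : ℕ) : Set WBox := induced (boxesQ P D j)

/-- The boxes `I' × J'` of `R(j)` with `I' ⊆ I`. -/
def boxesRIn (P : Params) (D : RunData) (j : ℕ) (I : Ivl) : Set WBox :=
  {b | b ∈ boxesR P D j ∧ b.I.Sub I}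

/-- The result of Preprocess at level `j`. -/
def PreprocessAt (P : Params) (D : RunData) (j : ℕ) : Prop :=
  ∀ i ≤ P.L, ∀ I ∈ P.hIvls j,
    if j = 1 then D.sample j I i = 0 ∧ D.bbelow j I i = ∅
    else
      (sparseIn P D j I i = ∅ → D.sample j I i = 0) ∧
      ((sparseIn P D j I i).Nonempty →
        Multiset.card (D.sample j I i) = 30 * Nat.log 2 P.n ∧
        ∀ I' ∈ D.sample j I i, I' ∈ sparseIn P D j I i) ∧
      D.bbelow j I i =
        APM I (P.vIvls j i) (eps ((i : ℤ) - P.c (j - 1) - 5)) (boxesRIn P D (j - 1) I)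

/-- The state of the while loop of ProcessDense for a fixed level and index. -/
structure LoopState where
  todo : Finset Ivl
  sparse : Finset Ivl
  pivots : Finset Ivl
  bdense : Ivl → Finset Ivl

/-- The initial state of the while loop. -/
def LoopState.init (P : Params) (j : ℕ) : LoopState := ⟨P.hIvls j, ∅, ∅, fun _ => ∅⟩

/-- The state after `I` was declared sparse. -/
def LoopState.declareSparse (s : LoopState) (I : Ivl) : LoopState :=
  { s with todo := s.todo \ {I}, sparse := s.sparse ∪ {I} }

/-- The state after the round with pivot `I` that found the sets `X` and `Y`. -/
def LoopState.usePivot (s : LoopState) (I : Ivl) (X Y : Finset Ivl) : LoopState :=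
  { s with
    todo := s.todo \ X
    pivots := s.pivots ∪ {I}
    bdense := fun I' => if I' ∈ X then Y else s.bdense I' }

/-- `S` is a possible outcome of including every element of `A` independently with
probability `p`, where `p > 0`. -/
def PossibleSample (A : Finset Ivl) (p : ℝ) (S : Finset Ivl) : Prop :=
  S ⊆ A ∧ (1 ≤ p → S = A)

/-- The set `X` of a round of ProcessDense with pivot `I`. -/
noncomputable def pivotX (P : Params) (acc : Ivl → Ivl → ℕ → Prop) (D : RunData) (j i : ℕ)
    (I : Ivl) : Finset Ivl :=
  enumerate P acc D j I (P.hIvls j) (i - P.c (j - 1) - 7)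

/-- The set `Y` of a round of ProcessDense with pivot `I`. -/
noncomputable def pivotY (P : Params) (acc : Ivl → Ivl → ℕ → Prop) (D : RunData) (j i : ℕ)
    (I : Ivl) : Finset Ivl :=
  let h₂ := i - 2 * P.c (j - 1) - 14
  (P.vIvls j i).filter fun J => roundDown J (h₂ + 3) ∈ enumerate P acc D j I (P.vIvls j h₂) h₂

/-- `DenseLoop P acc D j i s s'`: the while loop of ProcessDense at level `j` and index `i`,
started in the state `s`, can terminate in the state `s'`. -/
inductive DenseLoop (P : Params) (acc : Ivl → Ivl → ℕ → Prop) (D : RunData) (j i : ℕ) :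
    LoopState → LoopState → Prop
  | done (s : LoopState) : s.todo = ∅ → DenseLoop P acc D j i s s
  | sparse (s s' : LoopState) (I : Ivl) (S : Finset Ivl) :
      I ∈ s.todo → PossibleSample (P.vIvls j i) (P.prob j) S →
      ((enumerate P acc D j I S i).card : ℝ) < P.prob j * P.d j →
      DenseLoop P acc D j i (s.declareSparse I) s' →
      DenseLoop P acc D j i s s'
  | dense (s s' : LoopState) (I : Ivl) (S : Finset Ivl) :
      I ∈ s.todo → PossibleSample (P.vIvls j i) (P.prob j) S →
      P.prob j * P.d j ≤ ((enumerate P acc D j I S i).card : ℝ) →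
      DenseLoop P acc D j i (s.usePivot I (pivotX P acc D j i I) (pivotY P acc D j i I)) s' →
      DenseLoop P acc D j i s s'

/-- The result of ProcessDense at level `j`. -/
def ProcessDenseAt (P : Params) (acc : Ivl → Ivl → ℕ → Prop) (D : RunData) (j : ℕ) : Prop :=
  ∀ i ≤ P.L,
    if i ≤ P.c j then
      D.sparse j i = ∅ ∧ D.pivots j i = ∅ ∧ ∀ I ∈ P.hIvls j, D.bdense j I i = P.vIvls j i
    else
      ∃ s, DenseLoop P acc D j i (LoopState.init P j) s ∧
        D.sparse j i = s.sparse ∧ D.pivots j i = s.pivots ∧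
        ∀ I ∈ P.hIvls j, D.bdense j I i = s.bdense I

/-- `D` is the data produced by the `k` iterations of a run of the algorithm. -/
def IsRun (P : Params) (acc : Ivl → Ivl → ℕ → Prop) (D : RunData) : Prop :=
  ∀ j, 1 ≤ j → j ≤ P.k → PreprocessAt P D j ∧ ProcessDenseAt P acc D j

/-- Acceptance by the gap subroutine: all calls use the same seed `ω` and error parameter
`n^{-12}`. -/
def accepts {Ω α : Type*} (P : Params) (ED : GapAlgorithm Ω α) (ω : Ω) (z : List α)
    (I J : Ivl) (i : ℕ) : Prop :=
  ED ω I.width (eps i) ((P.n : ℝ) ^ (-12 : ℤ)) (substr z I) (substr z J) = true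

/-- Successful randomization of a run. -/
structure SuccessfulRandomization {α : Type*} (P : Params) (ζ : ℝ) (z : List α)
    (acc : Ivl → Ivl → ℕ → Prop) (D : RunData) : Prop where
  /-- No call of the gap subroutine on a candidate fails to accept a close pair. -/
  ed_accept : ∀ j, 1 ≤ j → j ≤ P.k → ∀ i ≤ P.L, ∀ I ∈ P.hIvls j, ∀ J ∈ P.vIvls j i,
    (editd (substr z I) (substr z J) : ℝ) ≤ eps i * P.w j → acc I J i
  /-- The calls are also correct on far pairs.  This is required only below the threshold
  `w_j ^ (-ζ)`; above it, it is a consequence of the gap condition. -/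
  ed_reject : ∀ j, 1 ≤ j → j ≤ P.k → ∀ i ≤ P.L, ∀ I ∈ P.hIvls j, ∀ J ∈ P.vIvls j i,
    eps i < (P.w j : ℝ) ^ (-ζ) →
    P.Q * eps i * P.w j < (editd (substr z I) (substr z J) : ℝ) → ¬ acc I J i
  /-- If at least a third of the sparse subintervals of `I` are markers of a candidate, then one
  of these is sampled. -/
  sample_hits : ∀ j, 2 ≤ j → j ≤ P.k → ∀ i ≤ P.L, ∀ I ∈ P.hIvls j, ∀ J ∈ P.vIvls j i,
    ∀ i' ≤ i, (sparseIn P D j I i').Nonempty →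
    ((sparseIn P D j I i').card : ℝ) / 3 ≤ (winners P acc D j I J i i').card →
    ∃ I' ∈ D.sample j I i', I' ∈ winners P acc D j I J i i'
  /-- No interval with few CLOSE partners is declared dense. -/
  pivot_ok : ∀ j, 1 ≤ j → j ≤ P.k → ∀ i ≤ P.L, ∀ I ∈ D.pivots j i,
    (P.d j : ℝ) / 2 ≤ (enumerate P acc D j I (P.vIvls j i) i).card
  /-- No interval with many CLOSE partners is declared sparse. -/
  sparse_ok : ∀ j, 1 ≤ j → j ≤ P.k → ∀ i ≤ P.L, ∀ I ∈ D.sparse j i,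
    ((enumerate P acc D j I (P.vIvls j i) i).card : ℝ) ≤ 2 * P.d j

/-! ### The properties enforced at level `j` -/

/-- The properties of the data at level `j`, for the candidate `(i; I × J)` and the candidate
stack `(i; I × Js)`. -/
structure LevelProperties {α : Type*} (P : Params) (z : List α) (acc : Ivl → Ivl → ℕ → Prop)
    (D : RunData) (j i : ℕ) (I J : Ivl) (Js : Finset Ivl) : Prop where
  bbelow_sound : J ∈ D.bbelow j I i → ncost z I J ≤ eps ((i : ℤ) - P.c (j - 1) - 6)
  bbelow_complete : 2 ≤ j → ncost z I J ≤ eps i →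
    J ∈ D.bbelow j I i ∨
    ∃ i' ≤ i, (1 / 3 : ℝ) * (sparseIn P D j I i').card < (winners P acc D j I J i i').card
  enumerate_consistent :
    (J ∈ enumerate P acc D j I Js i ↔ J ∈ Js ∧ J ∈ enumerate P acc D j I {J} i) ∧
    (J ∈ enumerate P acc D j I {J} i ↔ IsClose P acc D j I J i) ∧
    (J ∉ enumerate P acc D j I {J} i ↔ IsFar P acc D j I J i)
  enumerate_sound : IsClose P acc D j I J i → ncost z I J ≤ eps ((i : ℤ) - P.c (j - 1) - 6)
  enumerate_complete : ncost z I J ≤ eps i → IsClose P acc D j I J i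
  sparse_valid : I ∈ D.sparse j i → (enumerate P acc D j I (P.vIvls j i) i).card ≤ 2 * P.d j
  bdense_sound : J ∈ D.bdense j I i → ncost z I J ≤ eps ((i : ℤ) - P.c j)
  bdense_complete : I ∉ D.sparse j i → ncost z I J ≤ eps i → J ∈ D.bdense j I i
  boxesR_sound : ∀ b ∈ boxesR P D j, b.Certified z
  boxesQ_complete : I ∉ D.sparse j i → ncost z I J ≤ eps i →
    (⟨I, J, eps ((i : ℤ) - P.c j)⟩ : WBox) ∈ boxesQ P D j ∧
    (P.c j ≤ P.L → (⟨I, J, min 1 (eps ((i : ℤ) - P.c j))⟩ : WBox) ∈ boxesQ P D j)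

end EditDist

namespace EditDist

variable {α : Type*}

/-! ### The edit distance is a metric -/

/-! Costs of boxes are edit distances as long as the intervals lie inside the string
(`cost_eq_editd`). Hence normalized costs of boxes of equal width are symmetric and satisfy the
triangle inequality, and moving the ends of an interval changes an edit distance by at most the
total movement (`editd_seg_dist`). With these two facts the claims about `bdense` are triangle
inequalities through the pivot and the rounded interval; the recursion for `c` is what makes the
error terms add up.

The substantial point is completeness of `bbelow` (`mem_APM_of_few`). Take a cheapest traversal of
`I × J` and cut it at the columns that separate the strips of the previous level. A strip crossed at
cost `κ` is cheap at scale `l` if `4κ ≤ ε_l w'`, with `w'` the width of a strip. At a scale where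
the strip is cheap and not sparse, the previous level supplies a box of comparable weight, and one
of its induced boxes fits the crossing. A strip that is sparse at its finest cheap scales must fall
back to a coarser one. If, at every scale, at most a third of the sparse strips are winners, these
losses can be charged to the sparse strips that are not cheap there, and the total weight grows only
by the factor 3/2 (`sum_half_pow_le`). So either the pattern match finds `J`, or at some scale more
than a third of the sparse strips are winners, in which case the sample hits one and the candidate
is passed to the gap subroutine. Soundness of the pattern match loses only a factor 2
(`ncost_le_of_mem_APM`).

`enumerate` decides each candidate independently of the stack it comes in (`mem_enumerate_iff`), so
CLOSE is a property of a single candidate. Everything is then closed by induction on the level in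
`levelCorrect`. -/

theorem EditStep.symm {u v : List α} (h : EditStep u v) : EditStep v u := by
  cases h with
  | insert p s a => exact .delete p s a
  | delete p s a => exact .insert p s a
  | subst p s a b => exact .subst p s b a

theorem EditStep.append_left {u v : List α} (h : EditStep u v) (t : List α) :
    EditStep (t ++ u) (t ++ v) := by
  cases h with
  | insert p s a => simpa using EditStep.insert (t ++ p) s a
  | delete p s a => simpa using EditStep.delete (t ++ p) s a
  | subst p s a b => simpa using EditStep.subst (t ++ p) s a b

theorem EditStep.append_right {u v : List α} (h : EditStep u v) (t : List α) :
    EditStep (u ++ t) (v ++ t) := by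
  cases h with
  | insert p s a => simpa using EditStep.insert p (s ++ t) a
  | delete p s a => simpa using EditStep.delete p (s ++ t) a
  | subst p s a b => simpa using EditStep.subst p (s ++ t) a b

theorem EditStep.length_le {u v : List α} (h : EditStep u v) : v.length ≤ u.length + 1 := by
  cases h <;> simp <;> omega

theorem EditsIn.trans {k l : ℕ} {u v t : List α} (h : EditsIn k u v) (h' : EditsIn l v t) :
    EditsIn (k + l) u t := by
  induction h' with
  | refl => exact h
  | step _ hs ih => exact (ih h).step hs

theorem EditsIn.symm {k : ℕ} {u v : List α} (h : EditsIn k u v) : EditsIn k v u := by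
  induction h with
  | refl => exact .refl _
  | @step k u v t _ hs ih =>
    have := ((EditsIn.refl t).step hs.symm).trans ih
    rwa [zero_add, add_comm] at this

theorem EditsIn.append_left {k : ℕ} {u v : List α} (h : EditsIn k u v) (t : List α) :
    EditsIn k (t ++ u) (t ++ v) := by
  induction h with
  | refl => exact .refl _
  | step _ hs ih => exact ih.step (hs.append_left t)

theorem EditsIn.append_right {k : ℕ} {u v : List α} (h : EditsIn k u v) (t : List α) :
    EditsIn k (u ++ t) (v ++ t) := by
  induction h with
  | refl => exact .refl _
  | step _ hs ih => exact ih.step (hs.append_right t)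

theorem EditsIn.length_le {k : ℕ} {u v : List α} (h : EditsIn k u v) :
    v.length ≤ u.length + k := by
  induction h with
  | refl => simp
  | step _ hs ih => have := hs.length_le; omega

theorem EditsIn.of_nil (v : List α) : EditsIn v.length [] v := by
  induction v with
  | nil => exact .refl _
  | cons a v ih => simpa using ih.step (.insert [] v a)

theorem editd_le {k : ℕ} {u v : List α} (h : EditsIn k u v) : editd u v ≤ k := Nat.sInf_le h

/-- The infimum is attained because some edit sequence exists: delete all of `u`, then insert all of
`v`. -/
theorem editsIn_editd (u v : List α) : EditsIn (editd u v) u v :=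
  Nat.sInf_mem (s := {k | EditsIn k u v}) ⟨_, (EditsIn.of_nil u).symm.trans (EditsIn.of_nil v)⟩

@[simp]
theorem editd_self (u : List α) : editd u u = 0 := Nat.le_zero.1 (editd_le (.refl u))

theorem editd_comm (u v : List α) : editd u v = editd v u :=
  le_antisymm (editd_le (editsIn_editd v u).symm) (editd_le (editsIn_editd u v).symm)

theorem editd_triangle (u v t : List α) : editd u t ≤ editd u v + editd v t :=
  editd_le ((editsIn_editd u v).trans (editsIn_editd v t))

theorem editd_append_le (u u' v v' : List α) :
    editd (u ++ u') (v ++ v') ≤ editd u v + editd u' v' :=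
  editd_le (((editsIn_editd u v).append_right u').trans ((editsIn_editd u' v').append_left v))

theorem length_le_add_editd (u v : List α) : v.length ≤ u.length + editd u v :=
  (editsIn_editd u v).length_le

theorem editd_nil_left_le (v : List α) : editd [] v ≤ v.length := editd_le (.of_nil v)

theorem editd_singleton_le (a b : α) : editd [a] [b] ≤ 1 :=
  editd_le ((EditsIn.refl [a]).step (.subst [] [] a b))

theorem editd_option_toList_le (a b : Option α) : editd a.toList b.toList ≤ 1 := by
  cases a <;> cases b
  · simp
  · exact editd_nil_left_le _
  · rw [editd_comm]; exact editd_nil_left_le _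
  · exact editd_singleton_le _ _

/-! ### Segments of a string -/

/-- The characters of `z` strictly after position `a`, up to position `b`. -/
def seg (z : List α) (a b : ℕ) : List α := (z.drop a).take (b - a)

theorem substr_eq_seg (z : List α) (I : Ivl) : substr z I = seg z I.lo I.hi := by
  simp [substr, seg, Ivl.hi]

@[simp]
theorem seg_self (z : List α) (a : ℕ) : seg z a a = [] := by simp [seg]

theorem length_seg {z : List α} {a b : ℕ} (hb : b ≤ z.length) :
    (seg z a b).length = b - a := by
  simp [seg]; omega

theorem seg_append_seg (z : List α) {a b c : ℕ} (hab : a ≤ b) (hbc : b ≤ c) :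
    seg z a b ++ seg z b c = seg z a c := by
  obtain ⟨m, rfl⟩ := Nat.exists_eq_add_of_le hab
  obtain ⟨l, rfl⟩ := Nat.exists_eq_add_of_le hbc
  simp only [seg, Nat.add_sub_cancel_left, add_assoc]
  rw [List.take_add, List.drop_drop, ← add_assoc, Nat.add_sub_cancel_left]

theorem seg_succ (z : List α) (a : ℕ) : seg z a (a + 1) = z[a]?.toList := by
  simp only [seg, Nat.add_sub_cancel_left]
  rcases lt_or_ge a z.length with h | h
  · rw [List.drop_eq_getElem_cons h, List.getElem?_eq_getElem h]; rfl
  · simp [List.drop_eq_nil_of_le h, h]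

theorem length_seg_le (z : List α) (a b : ℕ) : (seg z a b).length ≤ b - a := by
  simp [seg]

theorem editd_seg_left_le (z : List α) {a a' b : ℕ} (h : a ≤ a') (h' : a' ≤ b) :
    editd (seg z a b) (seg z a' b) ≤ a' - a := by
  rw [← seg_append_seg z h h']
  have := editd_append_le (seg z a a') (seg z a' b) [] (seg z a' b)
  have h2 := editd_nil_left_le (seg z a a')
  rw [editd_comm] at h2
  have := length_seg_le z a a'
  simp at *
  omega

theorem editd_seg_right_le (z : List α) {a b b' : ℕ} (h : a ≤ b) (h' : b ≤ b') :
    editd (seg z a b) (seg z a b') ≤ b' - b := by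
  rw [← seg_append_seg z h h']
  have := editd_append_le (seg z a b) [] (seg z a b) (seg z b b')
  have h2 := editd_nil_left_le (seg z b b')
  have := length_seg_le z b b'
  simp at *
  omega

theorem editd_seg_left_dist (z : List α) {a a' b : ℕ} (h : a ≤ b) (h' : a' ≤ b) :
    editd (seg z a b) (seg z a' b) ≤ Nat.dist a a' := by
  rcases le_total a a' with h1 | h1
  · rw [Nat.dist_eq_sub_of_le h1]; exact editd_seg_left_le z h1 h'
  · rw [editd_comm, Nat.dist_comm, Nat.dist_eq_sub_of_le h1]; exact editd_seg_left_le z h1 h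

theorem editd_seg_right_dist (z : List α) {a b b' : ℕ} (h : a ≤ b) (h' : a ≤ b') :
    editd (seg z a b) (seg z a b') ≤ Nat.dist b b' := by
  rcases le_total b b' with h1 | h1
  · rw [Nat.dist_eq_sub_of_le h1]; exact editd_seg_right_le z h h1
  · rw [editd_comm, Nat.dist_comm, Nat.dist_eq_sub_of_le h1]; exact editd_seg_right_le z h' h1

theorem editd_seg_dist (z : List α) {a a' b b' : ℕ} (h : a ≤ b) (h' : a' ≤ b') :
    editd (seg z a b) (seg z a' b') ≤ Nat.dist a a' + Nat.dist b b' := by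
  -- The ends are moved one at a time, and the intermediate segment must not have crossed ends,
  -- where `seg` degenerates to the empty list. This decides which end moves first.
  rcases le_or_gt a' b with h1 | h1
  · exact (editd_triangle _ (seg z a' b) _).trans
      (add_le_add (editd_seg_left_dist z h h1) (editd_seg_right_dist z h1 h'))
  · have h2 : a ≤ b' := by omega
    rw [add_comm]
    exact (editd_triangle _ (seg z a b') _).trans
      (add_le_add (editd_seg_right_dist z h h2) (editd_seg_left_dist z h2 h'))

/-! ### Grid paths and the edit distance -/

theorem GridPath.le {z : List α} {p q : ℕ × ℕ} {c : ℕ} (h : GridPath z p q c) :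
    p.1 ≤ q.1 ∧ p.2 ≤ q.2 := by
  induction h <;> simp_all <;> omega

/-- Diagonal edges stay on their diagonal, while every edge that leaves it costs 1; so the cost
bounds the change of diagonal. -/
theorem GridPath.displacement_le {z : List α} {p q : ℕ × ℕ} {c : ℕ} (h : GridPath z p q c) :
    q.1 + p.2 ≤ q.2 + p.1 + c ∧ q.2 + p.1 ≤ q.1 + p.2 + c := by
  induction h <;> simp_all <;> omega

theorem GridPath.trans {z : List α} {p q r : ℕ × ℕ} {c d : ℕ} (h : GridPath z p q c)
    (h' : GridPath z q r d) : GridPath z p r (c + d) := by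
  induction h' with
  | nil => exact h
  | horiz _ ih => exact ih.horiz
  | vert _ ih => exact ih.vert
  | diag _ ih => rw [← add_assoc]; exact ih.diag

/-- Every edge appends at most one character to each segment. No bound by the length of `z` is
needed: beyond the end `z[i]?` is `none` and nothing is appended. -/
theorem GridPath.editd_le {z : List α} {p q : ℕ × ℕ} {c : ℕ} (h : GridPath z p q c) :
    editd (seg z p.1 q.1) (seg z p.2 q.2) ≤ c := by
  induction h with
  | nil => simp
  | @horiz i j c h ih =>
    have hle := h.le
    simp only at hle ih ⊢
    have h1 := editd_seg_right_le z hle.1 (Nat.le_succ i)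
    rw [editd_comm] at h1
    have := editd_triangle (seg z p.1 (i + 1)) (seg z p.1 i) (seg z p.2 j)
    simp only [Nat.succ_eq_add_one] at h1
    omega
  | @vert i j c h ih =>
    have hle := h.le
    simp only at hle ih ⊢
    have h1 := editd_seg_right_le z hle.2 (Nat.le_succ j)
    have := editd_triangle (seg z p.1 i) (seg z p.2 j) (seg z p.2 (j + 1))
    simp only [Nat.succ_eq_add_one] at h1
    omega
  | @diag i j c h ih =>
    have hle := h.le
    simp only at hle ih ⊢
    rw [← seg_append_seg z hle.1 (Nat.le_succ i), ← seg_append_seg z hle.2 (Nat.le_succ j),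
      Nat.succ_eq_add_one, Nat.succ_eq_add_one, seg_succ, seg_succ]
    refine (editd_append_le _ _ _ _).trans (add_le_add ih ?_)
    split_ifs with hz
    · simp [hz]
    · exact editd_option_toList_le _ _

/-! ### Alignments: from edit sequences back to grid paths -/

open Classical in
/-- Alignments of two strings, with their cost. -/
inductive Alignment : List α → List α → ℕ → Prop
  | nil : Alignment [] [] 0
  | del (a : α) {u v : List α} {c : ℕ} : Alignment u v c → Alignment (a :: u) v (c + 1)
  | ins (b : α) {u v : List α} {c : ℕ} : Alignment u v c → Alignment u (b :: v) (c + 1)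
  | pair (a b : α) {u v : List α} {c : ℕ} : Alignment u v c →
      Alignment (a :: u) (b :: v) (c + if a = b then 0 else 1)

theorem Alignment.refl (u : List α) : Alignment u u 0 := by
  induction u with
  | nil => exact .nil
  | cons a u ih => simpa using Alignment.pair a a ih

theorem Alignment.append {u v u' v' : List α} {c c' : ℕ} (h : Alignment u v c)
    (h' : Alignment u' v' c') : Alignment (u ++ u') (v ++ v') (c + c') := by
  induction h with
  | nil => simpa using h'
  | del a _ ih => rw [add_right_comm]; exact .del a ih
  | ins a _ ih => rw [add_right_comm]; exact .ins a ih
  | pair a b _ ih => rw [add_right_comm]; exact .pair a b ih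

theorem Alignment.split {u v : List α} {c : ℕ} (h : Alignment u v c) :
    ∀ p s : List α, v = p ++ s → ∃ u₁ u₂ c₁ c₂, u = u₁ ++ u₂ ∧ c = c₁ + c₂ ∧
      Alignment u₁ p c₁ ∧ Alignment u₂ s c₂ := by
  induction h with
  | nil =>
    intro p s h
    obtain ⟨rfl, rfl⟩ : p = [] ∧ s = [] := by simpa using h.symm
    exact ⟨[], [], 0, 0, rfl, rfl, .nil, .nil⟩
  | del a _ ih =>
    intro p s h
    obtain ⟨u₁, u₂, c₁, c₂, rfl, rfl, h₁, h₂⟩ := ih p s h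
    exact ⟨a :: u₁, u₂, c₁ + 1, c₂, rfl, by omega, .del a h₁, h₂⟩
  | @ins b u v c hal ih =>
    intro p s h
    cases p with
    | nil =>
      obtain rfl : s = b :: v := by simpa using h.symm
      exact ⟨[], u, 0, c + 1, rfl, by omega, .nil, .ins b hal⟩
    | cons b' p =>
      obtain ⟨rfl, hv⟩ : b = b' ∧ v = p ++ s := by simpa using h
      obtain ⟨u₁, u₂, c₁, c₂, rfl, rfl, h₁, h₂⟩ := ih p s hv
      exact ⟨u₁, u₂, c₁ + 1, c₂, rfl, by omega, .ins b h₁, h₂⟩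
  | @pair a b u v c hal ih =>
    intro p s h
    cases p with
    | nil =>
      obtain rfl : s = b :: v := by simpa using h.symm
      exact ⟨[], a :: u, 0, _, rfl, by simp, .nil, .pair a b hal⟩
    | cons b' p =>
      obtain ⟨rfl, hv⟩ : b = b' ∧ v = p ++ s := by simpa using h
      obtain ⟨u₁, u₂, c₁, c₂, rfl, rfl, h₁, h₂⟩ := ih p s hv
      exact ⟨a :: u₁, u₂, _, c₂, rfl, by omega, .pair a b h₁, h₂⟩

/-- The removed letter was either inserted, and then the insertion is dropped, or paired, and then
its partner becomes a deletion of cost 1. -/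
theorem Alignment.tail {u v : List α} {c : ℕ} (h : Alignment u v c) :
    ∀ (a : α) (s : List α), v = a :: s → ∃ c' ≤ c + 1, Alignment u s c' := by
  induction h with
  | nil => intro a s h; simp at h
  | del a _ ih =>
    intro b s h
    obtain ⟨c', hc, h'⟩ := ih b s h
    exact ⟨c' + 1, by omega, .del a h'⟩
  | @ins b u v c hal ih =>
    intro a s h
    obtain ⟨rfl, rfl⟩ : b = a ∧ v = s := by simpa using h
    exact ⟨c, by omega, hal⟩
  | @pair a b u v c hal ih =>
    intro a' s h
    obtain ⟨rfl, rfl⟩ : b = a' ∧ v = s := by simpa using h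
    exact ⟨c + 1, by omega, .del a hal⟩

theorem Alignment.replace_head {u v : List α} {c : ℕ} (h : Alignment u v c) :
    ∀ (a b : α) (s : List α), v = a :: s → ∃ c' ≤ c + 1, Alignment u (b :: s) c' := by
  induction h with
  | nil => intro a b s h; simp at h
  | del a _ ih =>
    intro b b' s h
    obtain ⟨c', hc, h'⟩ := ih b b' s h
    exact ⟨c' + 1, by omega, .del a h'⟩
  | @ins b u v c hal ih =>
    intro a b' s h
    obtain ⟨rfl, rfl⟩ : b = a ∧ v = s := by simpa using h
    exact ⟨c + 1, by omega, .ins b' hal⟩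
  | @pair a b u v c hal ih =>
    intro a' b' s h
    obtain ⟨rfl, rfl⟩ : b = a' ∧ v = s := by simpa using h
    exact ⟨_, by split_ifs <;> omega, .pair a b' hal⟩

/-- An edit sequence may touch the same place repeatedly, so it is not itself a monotone path.
Absorbing the edits one by one into an alignment, split at the place of the edit, straightens it out
at cost at most 1 per edit. -/
theorem Alignment.editStep {u v t : List α} {c : ℕ} (h : Alignment u v c) (hs : EditStep v t) :
    ∃ c' ≤ c + 1, Alignment u t c' := by
  cases hs with
  | insert p s a =>
    obtain ⟨u₁, u₂, c₁, c₂, rfl, rfl, h₁, h₂⟩ := h.split p s rfl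
    exact ⟨_, by omega, h₁.append (.ins a h₂)⟩
  | delete p s a =>
    obtain ⟨u₁, u₂, c₁, c₂, rfl, rfl, h₁, h₂⟩ := h.split p _ rfl
    obtain ⟨c', hc', h'⟩ := h₂.tail a s rfl
    exact ⟨_, by omega, h₁.append h'⟩
  | subst p s a b =>
    obtain ⟨u₁, u₂, c₁, c₂, rfl, rfl, h₁, h₂⟩ := h.split p _ rfl
    obtain ⟨c', hc', h'⟩ := h₂.replace_head a b s rfl
    exact ⟨_, by omega, h₁.append h'⟩

theorem EditsIn.exists_alignment {k : ℕ} {u v : List α} (h : EditsIn k u v) :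
    ∃ c ≤ k, Alignment u v c := by
  induction h with
  | refl u => exact ⟨0, le_rfl, .refl u⟩
  | step _ hs ih =>
    obtain ⟨c, hc, h⟩ := ih
    obtain ⟨c', hc', h'⟩ := h.editStep hs
    exact ⟨c', by omega, h'⟩

theorem getElem?_of_cons_prefix_drop {z u : List α} {a : α} {i : ℕ} (h : a :: u <+: z.drop i) :
    z[i]? = some a ∧ u <+: z.drop (i + 1) := by
  obtain ⟨t, ht⟩ := h
  constructor
  · have : (z.drop i)[0]? = some a := by rw [← ht]; simp
    simpa using this
  · refine ⟨t, ?_⟩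
    rw [← List.drop_drop, ← ht]; simp

/-- Deletions are horizontal edges, insertions vertical ones and pairs diagonal ones. -/
theorem Alignment.gridPath {z u v : List α} {c : ℕ} (h : Alignment u v c) :
    ∀ i j : ℕ, u <+: z.drop i → v <+: z.drop j →
      GridPath z (i, j) (i + u.length, j + v.length) c := by
  induction h with
  | nil => intro i j _ _; exact .nil _
  | @del a u v c _ ih =>
    intro i j hu hv
    have := (GridPath.nil (z := z) (i, j)).horiz.trans
      (ih (i + 1) j (getElem?_of_cons_prefix_drop hu).2 hv)
    convert this using 1
    · simp; omega
    · omega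
  | @ins b u v c _ ih =>
    intro i j hu hv
    have := (GridPath.nil (z := z) (i, j)).vert.trans
      (ih i (j + 1) hu (getElem?_of_cons_prefix_drop hv).2)
    convert this using 1
    · simp; omega
    · omega
  | @pair a b u v c _ ih =>
    intro i j hu hv
    have := (GridPath.nil (z := z) (i, j)).diag.trans
      (ih (i + 1) (j + 1) (getElem?_of_cons_prefix_drop hu).2 (getElem?_of_cons_prefix_drop hv).2)
    convert this using 1
    · simp; omega
    · rw [(getElem?_of_cons_prefix_drop hu).1, (getElem?_of_cons_prefix_drop hv).1]
      by_cases hab : a = b <;> simp [hab, add_comm]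

/-- The bounds by the length of `z` ensure that the segments are not truncated, so that the path
really ends at `(a', b')`. -/
theorem exists_gridPath_le_editd {z : List α} {a a' b b' : ℕ} (h : a ≤ a') (ha : a' ≤ z.length)
    (h' : b ≤ b') (hb : b' ≤ z.length) :
    ∃ c ≤ editd (seg z a a') (seg z b b'), GridPath z (a, b) (a', b') c := by
  obtain ⟨c, hc, hal⟩ := (editsIn_editd (seg z a a') (seg z b b')).exists_alignment
  refine ⟨c, hc, ?_⟩
  have := hal.gridPath (z := z) a b (List.take_prefix _ _) (List.take_prefix _ _)
  rw [length_seg ha, length_seg hb] at this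
  convert this using 2 <;> omega

theorem exists_gridPath_of_le (z : List α) {a a' b b' : ℕ} (h : a ≤ a') (h' : b ≤ b') :
    ∃ c, GridPath z (a, b) (a', b') c := by
  induction a', h using Nat.le_induction with
  | base =>
    induction b', h' using Nat.le_induction with
    | base => exact ⟨0, .nil _⟩
    | succ m _ ih => obtain ⟨c, hc⟩ := ih; exact ⟨_, hc.vert⟩
  | succ m _ ih => obtain ⟨c, hc⟩ := ih; exact ⟨_, hc.horiz⟩

theorem Ivl.lo_le_hi (I : Ivl) : I.lo ≤ I.hi := Nat.le_add_right _ _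

theorem gridPath_cost (z : List α) (I J : Ivl) :
    GridPath z (I.lo, J.lo) (I.hi, J.hi) (cost z I J) :=
  Nat.sInf_mem (s := {c | GridPath z (I.lo, J.lo) (I.hi, J.hi) c})
    (exists_gridPath_of_le z I.lo_le_hi J.lo_le_hi)

theorem editd_le_cost (z : List α) (I J : Ivl) :
    editd (substr z I) (substr z J) ≤ cost z I J := by
  rw [substr_eq_seg, substr_eq_seg]
  exact (gridPath_cost z I J).editd_le

theorem cost_eq_editd {z : List α} {I J : Ivl} (hI : I.hi ≤ z.length) (hJ : J.hi ≤ z.length) :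
    cost z I J = editd (substr z I) (substr z J) := by
  refine le_antisymm ?_ (editd_le_cost z I J)
  obtain ⟨c, hc, h⟩ := exists_gridPath_le_editd I.lo_le_hi hI J.lo_le_hi hJ
  rw [substr_eq_seg, substr_eq_seg]
  exact (Nat.sInf_le (s := {c | GridPath z (I.lo, J.lo) (I.hi, J.hi) c}) h).trans hc

theorem cost_le_width {z : List α} {I J : Ivl} (h : J.width = I.width) :
    cost z I J ≤ I.width := by
  have key : ∀ m, ∃ c ≤ m, GridPath z (I.lo, J.lo) (I.lo + m, J.lo + m) c := by
    intro m
    induction m with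
    | zero => exact ⟨0, le_rfl, .nil _⟩
    | succ m ih =>
      obtain ⟨c, hc, hp⟩ := ih
      exact ⟨_, by split_ifs <;> omega, hp.diag⟩
  obtain ⟨c, hc, hp⟩ := key I.width
  refine le_trans (Nat.sInf_le ?_) hc
  simpa [Ivl.hi, h] using hp

theorem ncost_le_iff {z : List α} {I J : Ivl} {κ : ℝ} (h : 0 < I.width) :
    ncost z I J ≤ κ ↔ (cost z I J : ℝ) ≤ κ * I.width := by
  rw [ncost, div_le_iff₀ (by exact_mod_cast h)]

/-! ### Cutting a grid path along columns -/

/-- No edge advances by more than one column, so the path has a vertex on every column between its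
ends. -/
theorem GridPath.exists_cut {z : List α} {p q : ℕ × ℕ} {c : ℕ} (h : GridPath z p q c) :
    ∀ x, p.1 ≤ x → x ≤ q.1 → ∃ y c₁ c₂, c = c₁ + c₂ ∧ GridPath z p (x, y) c₁ ∧
      GridPath z (x, y) q c₂ := by
  induction h with
  | nil =>
    intro x h₁ h₂
    obtain rfl : x = p.1 := le_antisymm h₂ h₁
    exact ⟨p.2, 0, 0, rfl, .nil _, .nil _⟩
  | @horiz i j c h ih =>
    intro x h₁ h₂
    rcases Nat.lt_or_ge i x with hx | hx
    · obtain rfl : x = i + 1 := le_antisymm h₂ hx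
      exact ⟨j, c + 1, 0, rfl, h.horiz, .nil _⟩
    · obtain ⟨y, c₁, c₂, rfl, h', h''⟩ := ih x h₁ hx
      exact ⟨y, c₁, c₂ + 1, by omega, h', h''.horiz⟩
  | @vert i j c h ih =>
    intro x h₁ h₂
    obtain ⟨y, c₁, c₂, rfl, h', h''⟩ := ih x h₁ h₂
    exact ⟨y, c₁, c₂ + 1, by omega, h', h''.vert⟩
  | @diag i j c h ih =>
    intro x h₁ h₂
    rcases Nat.lt_or_ge i x with hx | hx
    · obtain rfl : x = i + 1 := le_antisymm h₂ hx
      exact ⟨j + 1, _, 0, rfl, h.diag, .nil _⟩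
    · obtain ⟨y, c₁, c₂, rfl, h', h''⟩ := ih x h₁ hx
      exact ⟨y, c₁, _, by rw [add_assoc], h', h''.diag⟩

/-- A grid path crossing consecutive strips of width `w` splits into crossings of the strips. -/
theorem GridPath.exists_strips {z : List α} {w x y : ℕ} (M : ℕ) :
    ∀ y' c : ℕ, GridPath z (x, y) (x + (M + 1) * w, y') c →
      ∃ h κ : ℕ → ℕ, h 0 = y ∧ h (M + 1) = y' ∧ ∑ a ∈ Finset.range (M + 1), κ a = c ∧
        ∀ a ≤ M, GridPath z (x + a * w, h a) (x + (a + 1) * w, h (a + 1)) (κ a) := by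
  induction M with
  | zero =>
    intro y' c hp
    refine ⟨fun a => if a = 0 then y else y', fun _ => c, rfl, rfl, by simp, ?_⟩
    intro a ha
    obtain rfl : a = 0 := Nat.le_zero.1 ha
    simpa using hp
  | succ M ih =>
    intro y' c hp
    obtain ⟨y'', c₁, c₂, rfl, hp₁, hp₂⟩ := hp.exists_cut (x + (M + 1) * w)
      (Nat.le_add_right _ _) (Nat.add_le_add_left (Nat.mul_le_mul_right _ (by omega)) _)
    obtain ⟨h, κ, h0, hM, hκ, hall⟩ := ih y'' c₁ hp₁
    refine ⟨fun a => if a = M + 2 then y' else h a, fun a => if a = M + 1 then c₂ else κ a,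
      by simpa using h0, by simp, ?_, ?_⟩
    · rw [Finset.sum_range_succ, ← hκ, if_pos rfl]
      congr 1
      refine Finset.sum_congr rfl fun a ha => if_neg ?_
      exact (Finset.mem_range.1 ha).ne
    · intro a ha
      rcases Nat.lt_or_ge M a with h1 | h1
      · obtain rfl : a = M + 1 := by omega
        simpa [hM] using hp₂
      · have e1 : a ≠ M + 2 := by omega
        have e2 : a + 1 ≠ M + 2 := by omega
        have e3 : a ≠ M + 1 := by omega
        simpa only [if_neg e1, if_neg e2, if_neg e3] using hall a h1

/-! ### Paths in shortcut graphs -/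

theorem ShortcutPath.vert_add {E : Set WEdge} {p : ℕ × ℕ} {x y : ℕ} {c : ℝ}
    (h : ShortcutPath E p (x, y) c) (m : ℕ) : ShortcutPath E p (x, y + m) (c + m) := by
  induction m with
  | zero => simpa using h
  | succ m ih => simpa [add_assoc] using ih.vert

theorem ShortcutPath.horiz_add {E : Set WEdge} {p : ℕ × ℕ} {x y : ℕ} {c : ℝ}
    (h : ShortcutPath E p (x, y) c) (m : ℕ) : ShortcutPath E p (x + m, y) (c + m) := by
  induction m with
  | zero => simpa using h
  | succ m ih => simpa [add_assoc] using ih.horiz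

/-- The edges of cost 0 which the approximate pattern match adds to the shortcut graph. -/
def freeEdges (I : Ivl) (Js : Finset Ivl) : Set WEdge :=
  {e | ∃ J' ∈ Js, e = ⟨(I.lo, 0), (I.lo, J'.lo), 0⟩}

/-- The invariant of a path is that its cost pays for matching the columns crossed so far with a
segment starting at some height `b`. Certified boxes and unit edges extend the match. A free edge
ends on column `I.lo`, where the horizontal segment is still empty, so the match restarts there with
`b = J'.lo`. -/
theorem ShortcutPath.exists_editd_le {z : List α} {R : Set WBox}
    (hR : ∀ b ∈ R, 0 < b.I.width ∧ b.Certified z) (I : Ivl) (Js : Finset Ivl)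
    {q : ℕ × ℕ} {c : ℝ}
    (h : ShortcutPath (shortcutEdges R ∪ freeEdges I Js) (I.lo, 0) q c) :
    I.lo ≤ q.1 ∧ ∃ b ≤ q.2, (editd (seg z I.lo q.1) (seg z b q.2) : ℝ) ≤ c := by
  induction h with
  | nil => exact ⟨le_rfl, 0, le_rfl, by simp⟩
  | @horiz i j c h ih =>
    obtain ⟨h₁, b, hb, h₂⟩ := ih
    simp only at h₁ hb h₂ ⊢
    refine ⟨by omega, b, hb, ?_⟩
    have h3 := editd_triangle (seg z I.lo (i + 1)) (seg z I.lo i) (seg z b j)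
    have h4 := editd_seg_right_le z h₁ (Nat.le_succ i)
    rw [editd_comm] at h4
    have h5 : editd (seg z I.lo (i + 1)) (seg z b j) ≤ editd (seg z I.lo i) (seg z b j) + 1 := by
      simp only [Nat.succ_eq_add_one] at h4
      omega
    have h6 : (editd (seg z I.lo (i + 1)) (seg z b j) : ℝ) ≤
      editd (seg z I.lo i) (seg z b j) + 1 := by exact_mod_cast h5
    linarith
  | @vert i j c h ih =>
    obtain ⟨h₁, b, hb, h₂⟩ := ih
    simp only at h₁ hb h₂ ⊢
    refine ⟨h₁, b, by omega, ?_⟩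
    have h3 := editd_triangle (seg z I.lo i) (seg z b j) (seg z b (j + 1))
    have h4 := editd_seg_right_le z hb (Nat.le_succ j)
    have h5 : editd (seg z I.lo i) (seg z b (j + 1)) ≤ editd (seg z I.lo i) (seg z b j) + 1 := by
      simp only [Nat.succ_eq_add_one] at h4
      omega
    have h6 : (editd (seg z I.lo i) (seg z b (j + 1)) : ℝ) ≤
      editd (seg z I.lo i) (seg z b j) + 1 := by exact_mod_cast h5
    linarith
  | @shortcut c e he h ih =>
    obtain ⟨h₁, b, hb, h₂⟩ := ih
    rcases he with ⟨B, hB, rfl⟩ | ⟨J', hJ', rfl⟩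
    · simp only at h₁ hb h₂ ⊢
      refine ⟨h₁.trans B.I.lo_le_hi, b, hb.trans B.J.lo_le_hi, ?_⟩
      have hcert : (cost z B.I B.J : ℝ) ≤ B.κ * B.I.width :=
        (ncost_le_iff (hR B hB).1).1 (hR B hB).2
      have h3 : (editd (seg z B.I.lo B.I.hi) (seg z B.J.lo B.J.hi) : ℝ) ≤ cost z B.I B.J := by
        have := editd_le_cost z B.I B.J
        rw [substr_eq_seg, substr_eq_seg] at this
        exact_mod_cast this
      have h4 := editd_append_le (seg z I.lo B.I.lo) (seg z B.I.lo B.I.hi) (seg z b B.J.lo)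
        (seg z B.J.lo B.J.hi)
      rw [seg_append_seg z h₁ B.I.lo_le_hi, seg_append_seg z hb B.J.lo_le_hi] at h4
      have h5 : (editd (seg z I.lo B.I.hi) (seg z b B.J.hi) : ℝ) ≤
        editd (seg z I.lo B.I.lo) (seg z b B.J.lo) +
          editd (seg z B.I.lo B.I.hi) (seg z B.J.lo B.J.hi) := by exact_mod_cast h4
      linarith
    · refine ⟨le_rfl, J'.lo, le_rfl, ?_⟩
      have : (0 : ℝ) ≤ editd (seg z I.lo (I.lo, 0).1) (seg z b (I.lo, 0).2) := Nat.cast_nonneg _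
      simp only [seg_self, editd_self, Nat.cast_zero, add_zero]
      exact this.trans h₂

theorem ShortcutPath.nonneg {E : Set WEdge} (hE : ∀ e ∈ E, 0 ≤ e.wt) {p q : ℕ × ℕ} {c : ℝ}
    (h : ShortcutPath E p q c) : 0 ≤ c := by
  induction h with
  | nil => exact le_rfl
  | horiz _ ih => linarith
  | vert _ ih => linarith
  | shortcut e he _ ih => linarith [hE e he]

/-- Nonnegative weights keep the set of path costs bounded below, so that the real infimum is a
lower bound for it. -/
theorem shortcutCost_le {E : Set WEdge} (hE : ∀ e ∈ E, 0 ≤ e.wt) {p q : ℕ × ℕ} {c : ℝ}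
    (h : ShortcutPath E p q c) : shortcutCost E p q ≤ c :=
  csInf_le ⟨0, fun _ h => ShortcutPath.nonneg hE h⟩ h

/-- The factor 2 is the price of the unknown start `b`. Since `I` and `J` have equal width, `b`
differs from `J.lo` by the difference in length of the two matched segments, which is at most their
edit distance. -/
theorem editd_le_of_prefix_match {z : List α} {I J : Ivl} (hI : I.hi ≤ z.length)
    (hJ : J.hi ≤ z.length) (hIJ : J.width = I.width) {b : ℕ} (hb : b ≤ J.hi) :
    editd (substr z I) (substr z J) ≤ 2 * editd (seg z I.lo I.hi) (seg z b J.hi) := by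
  rw [substr_eq_seg, substr_eq_seg]
  have h1 := editd_triangle (seg z I.lo I.hi) (seg z b J.hi) (seg z J.lo J.hi)
  have h2 := editd_seg_left_dist z hb J.lo_le_hi
  have h3 := length_le_add_editd (seg z I.lo I.hi) (seg z b J.hi)
  have h4 := length_le_add_editd (seg z b J.hi) (seg z I.lo I.hi)
  rw [editd_comm, length_seg hI, length_seg hJ] at h4
  rw [length_seg hI, length_seg hJ] at h3
  simp only [Ivl.hi, Nat.dist] at *
  omega

/-- Soundness of the approximate pattern match. -/
theorem ncost_le_of_mem_APM {z : List α} {R : Set WBox}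
    (hR : ∀ b ∈ R, 0 < b.I.width ∧ b.Certified z) {I J : Ivl} {Js : Finset Ivl} {κ : ℝ}
    (hw : 0 < I.width) (hI : I.hi ≤ z.length)
    (hJ : J.hi ≤ z.length) (hIJ : J.width = I.width) (h : J ∈ APM I Js κ R) :
    ncost z I J ≤ 2 * κ := by
  have h1 := (Finset.mem_filter.1 h).2
  rw [ncost_le_iff hw, cost_eq_editd hI hJ]
  suffices H : (editd (substr z I) (substr z J) : ℝ) / 2 ≤
      shortcutCost (shortcutEdges R ∪ freeEdges I Js) (I.lo, 0) (I.hi, J.hi) by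
    have h1 : shortcutCost (shortcutEdges R ∪ freeEdges I Js) (I.lo, 0) (I.hi, J.hi) ≤
      κ * I.width := h1
    linarith
  -- Going straight across and then up shows that the set of path costs is nonempty, as a lower
  -- bound on its infimum requires.
  have hp := ((ShortcutPath.nil (E := shortcutEdges R ∪ freeEdges I Js)
    (I.lo, 0)).horiz_add I.width).vert_add J.hi
  rw [Nat.zero_add] at hp
  refine le_csInf ⟨_, hp⟩ fun c hc => ?_
  obtain ⟨-, b, hb, hle⟩ := ShortcutPath.exists_editd_le hR I Js hc
  have := editd_le_of_prefix_match hI hJ hIJ hb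
  have : (editd (substr z I) (substr z J) : ℝ) ≤ 2 * editd (seg z I.lo I.hi) (seg z b J.hi) := by
    exact_mod_cast this
  simp only at hle
  linarith

/-! ### Powers of two and aligned intervals -/

theorem eps_pos (i : ℤ) : 0 < eps i := by unfold eps; positivity

theorem eps_add (i j : ℤ) : eps (i + j) = eps i * eps j := by
  unfold eps; rw [neg_add, zpow_add₀ two_ne_zero]

theorem eps_natCast (i : ℕ) : eps i = (1 / 2 : ℝ) ^ i := by
  unfold eps; simp

theorem eps_sub_natCast (i : ℤ) (c : ℕ) : eps (i - c) = 2 ^ c * eps i := by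
  unfold eps; rw [neg_sub, sub_eq_add_neg, zpow_add₀ two_ne_zero, zpow_natCast]

theorem eps_anti {i j : ℤ} (h : i ≤ j) : eps j ≤ eps i :=
  zpow_le_zpow_right₀ one_le_two (neg_le_neg h)

theorem eps_zero : eps 0 = 1 := by simp [eps]

theorem eps_add_one (i : ℤ) : eps i = 2 * eps (i + 1) := by
  rw [eps_add]; norm_num [eps]; ring

theorem alignStep_two_pow (m s : ℕ) : alignStep (2 ^ m) s = 2 ^ (m - s) := by
  unfold alignStep
  rcases le_total s m with h | h
  · rw [Nat.pow_div h two_pos]; exact max_eq_left Nat.one_le_two_pow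
  · rw [Nat.sub_eq_zero_of_le h, pow_zero, max_eq_right]
    exact (Nat.div_le_div_right (Nat.pow_le_pow_right two_pos h)).trans (Nat.div_self (by positivity)).le

theorem mem_alignedIvls {n w : ℕ} {I : Ivl} :
    I ∈ alignedIvls n w ↔ I.width = w ∧ w ∣ I.lo ∧ I.hi ≤ n := by
  simp only [alignedIvls, Finset.mem_filter, Finset.mem_image, Finset.mem_range]
  constructor
  · rintro ⟨⟨a, -, rfl⟩, h⟩; exact ⟨rfl, h⟩
  · rintro ⟨rfl, h⟩
    exact ⟨⟨I.lo, Nat.lt_succ_of_le (I.lo_le_hi.trans h.2), rfl⟩, h⟩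

theorem mem_epsAlignedIvls {n w s : ℕ} {J : Ivl} :
    J ∈ epsAlignedIvls n w s ↔ J.width = w ∧ alignStep w s ∣ J.lo ∧ J.hi ≤ 2 * n := by
  simp only [epsAlignedIvls, Finset.mem_filter, Finset.mem_image, Finset.mem_range]
  constructor
  · rintro ⟨⟨a, -, rfl⟩, h⟩; exact ⟨rfl, h⟩
  · rintro ⟨rfl, h⟩
    exact ⟨⟨J.lo, Nat.lt_succ_of_le (J.lo_le_hi.trans h.2), rfl⟩, h⟩

theorem mod_two_pow_sub_le (y m s : ℕ) : ((y % 2 ^ (m - s) : ℕ) : ℝ) ≤ 2 ^ m * eps s := by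
  rw [eps_natCast]
  rcases le_total s m with h | h
  · have h1 : ((y % 2 ^ (m - s) : ℕ) : ℝ) ≤ 2 ^ (m - s) := by
      exact_mod_cast (Nat.mod_lt y (by positivity)).le
    rwa [pow_sub₀ _ two_ne_zero h, ← one_div, ← one_div_pow] at h1
  · rw [Nat.sub_eq_zero_of_le h, pow_zero, Nat.mod_one]; simp only [Nat.cast_zero]; positivity

/-- A crossing of the strip of width `2 ^ m` at `x` is close to a square box whose vertical interval
is aligned and stays within a given aligned range. -/
theorem GridPath.exists_aligned {z : List α} {x y y' κ m s a b : ℕ}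
    (hp : GridPath z (x, y) (x + 2 ^ m, y') κ) (ha : 2 ^ (m - s) ∣ a) (hb : 2 ^ (m - s) ∣ b)
    (hay : a ≤ y) (hyb : y' ≤ b) (hab : a + 2 ^ m ≤ b) :
    ∃ lo, 2 ^ (m - s) ∣ lo ∧ a ≤ lo ∧ lo + 2 ^ m ≤ b ∧
      Nat.dist y lo ≤ κ + y % 2 ^ (m - s) ∧ Nat.dist y' (lo + 2 ^ m) ≤ κ + y % 2 ^ (m - s) ∧
      editd (seg z x (x + 2 ^ m)) (seg z lo (lo + 2 ^ m)) ≤ 2 * κ + 2 * (y % 2 ^ (m - s)) := by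
  set d := 2 ^ (m - s) with hd
  have hdw : d ∣ 2 ^ m := pow_dvd_pow 2 (Nat.sub_le m s)
  have hdisp := hp.displacement_le
  have hle := hp.le
  have hmod := Nat.div_add_mod y d
  simp only at hdisp hle
  have hfin : ∀ lo, Nat.dist y lo + Nat.dist y' (lo + 2 ^ m) ≤ κ + 2 * (y % d) →
      editd (seg z x (x + 2 ^ m)) (seg z lo (lo + 2 ^ m)) ≤ 2 * κ + 2 * (y % d) := by
    intro lo hlo
    have h1 := hp.editd_le
    have h2 := editd_seg_dist z hle.2 (Nat.le_add_right lo (2 ^ m))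
    have h3 := editd_triangle (seg z x (x + 2 ^ m)) (seg z y y') (seg z lo (lo + 2 ^ m))
    simp only at h1
    omega
  -- The lower end is `y` rounded down to a multiple of `d`. If that interval would stick out above
  -- `b`, the topmost admissible one is used instead; as the crossing ends below `b` and rises by at
  -- least `2 ^ m - κ`, both its ends are within `κ`.
  rcases le_or_gt (d * (y / d) + 2 ^ m) b with h | h
  · refine ⟨d * (y / d), dvd_mul_right _ _, ?_, h, ?_, ?_, hfin _ ?_⟩
    · obtain ⟨q, rfl⟩ := ha
      exact Nat.mul_le_mul_left d ((Nat.le_div_iff_mul_le (by positivity)).2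
        (by rwa [mul_comm]))
    all_goals simp only [Nat.dist]; omega
  · refine ⟨b - 2 ^ m, Nat.dvd_sub hb hdw, by omega, by omega, ?_, ?_, hfin _ ?_⟩
    all_goals simp only [Nat.dist]; omega

/-! ### The counting argument -/

/-- `t` is one more than the last index below `n` with property `p`, or 0 if there is none. -/
theorem exists_last_index (p : ℕ → Prop) (n : ℕ) :
    ∃ t ≤ n, (t = 0 ∨ p (t - 1)) ∧ ∀ i, t ≤ i → i < n → ¬ p i := by
  induction n with
  | zero => exact ⟨0, le_rfl, .inl rfl, fun i _ h => absurd h (Nat.not_lt_zero i)⟩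
  | succ n ih =>
    by_cases h : p n
    · exact ⟨n + 1, le_rfl, .inr h, fun i h1 h2 => absurd h2 (not_lt.2 h1)⟩
    · obtain ⟨t, ht, h1, h2⟩ := ih
      refine ⟨t, ht.trans (Nat.le_succ n), h1, fun i hi hi' => ?_⟩
      rcases Nat.lt_succ_iff_lt_or_eq.1 hi' with h3 | rfl
      exacts [h2 i hi h3, h]

theorem sum_Ico_half_pow {s t : ℕ} (h : s ≤ t) :
    ∑ i ∈ Finset.Ico s t, (1 / 2 : ℝ) ^ (i + 1) = (1 / 2) ^ s - (1 / 2) ^ t := by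
  induction t, h using Nat.le_induction with
  | base => simp
  | succ t h ih => rw [Finset.sum_Ico_succ_top h, ih]; ring

theorem sum_range_ite_half_pow {s t n : ℕ} (h : s ≤ t) (hn : t ≤ n) :
    ∑ i ∈ Finset.range n, (if s ≤ i ∧ i < t then (1 / 2 : ℝ) ^ (i + 1) else 0) =
      (1 / 2) ^ s - (1 / 2) ^ t := by
  rw [← sum_Ico_half_pow h, ← Finset.sum_filter]
  refine Finset.sum_congr ?_ fun _ _ => rfl
  ext i
  simp only [Finset.mem_filter, Finset.mem_range, Finset.mem_Ico]
  omega

open Classical in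
/-- If at each index `i` at most a third of the members of `S i` satisfy `i < t a`, then lowering
the exponents `t a` to exponents `s a` such that all of `[s a, t a)` consists of indices `i` with
`a ∈ S i` increases the total of the weights `2 ^ (-t a)` by at most one half. -/
theorem sum_half_pow_le (A : Finset ℕ) (n : ℕ) (s t : ℕ → ℕ) (S : ℕ → ℕ → Prop)
    (hst : ∀ a ∈ A, s a ≤ t a) (ht : ∀ a ∈ A, t a ≤ n)
    (hS : ∀ a ∈ A, ∀ i, s a ≤ i → i < t a → S i a)
    (hfew : ∀ i < n, ((A.filter fun a => S i a ∧ i < t a).card : ℝ) ≤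
      1 / 3 * (A.filter fun a => S i a).card) :
    ∑ a ∈ A, (1 / 2 : ℝ) ^ s a ≤ 3 / 2 * ∑ a ∈ A, (1 / 2 : ℝ) ^ t a := by
  -- Both differences of powers are telescoped into sums over scales, and the order of summation is
  -- exchanged, so that the comparison can be made scale by scale.
  have h1 : ∑ a ∈ A, ((1 / 2 : ℝ) ^ s a - (1 / 2) ^ t a) =
      ∑ i ∈ Finset.range n, (A.filter fun a => s a ≤ i ∧ i < t a).card * (1 / 2 : ℝ) ^ (i + 1) := by
    rw [Finset.sum_congr rfl fun a ha => (sum_range_ite_half_pow (hst a ha) (ht a ha)).symm,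
      Finset.sum_comm]
    refine Finset.sum_congr rfl fun i _ => ?_
    rw [← Finset.sum_filter, Finset.sum_const, nsmul_eq_mul]
  have h2 : ∑ i ∈ Finset.range n,
      (A.filter fun a => t a ≤ i ∧ i < n).card * (1 / 2 : ℝ) ^ (i + 1) =
      ∑ a ∈ A, ((1 / 2 : ℝ) ^ t a - (1 / 2) ^ n) := by
    rw [Finset.sum_congr rfl fun a ha => (sum_range_ite_half_pow (ht a ha) le_rfl).symm,
      Finset.sum_comm]
    refine Finset.sum_congr rfl fun i _ => ?_
    rw [← Finset.sum_filter, Finset.sum_const, nsmul_eq_mul]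
  have h3 : ∑ a ∈ A, ((1 / 2 : ℝ) ^ t a - (1 / 2) ^ n) ≤ ∑ a ∈ A, (1 / 2 : ℝ) ^ t a :=
    Finset.sum_le_sum fun a _ => sub_le_self _ (by positivity)
  have h4 : ∑ i ∈ Finset.range n,
      (A.filter fun a => s a ≤ i ∧ i < t a).card * (1 / 2 : ℝ) ^ (i + 1) ≤
      ∑ i ∈ Finset.range n, 1 / 2 *
        ((A.filter fun a => t a ≤ i ∧ i < n).card * (1 / 2 : ℝ) ^ (i + 1)) := by
    refine Finset.sum_le_sum fun i hi => ?_
    have hin := Finset.mem_range.1 hi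
    rw [← mul_assoc]
    refine mul_le_mul_of_nonneg_right ?_ (by positivity)
    have e1 : ((A.filter fun a => s a ≤ i ∧ i < t a).card : ℝ) ≤
        (A.filter fun a => S i a ∧ i < t a).card := by
      refine Nat.cast_le.2 (Finset.card_le_card fun a ha => ?_)
      simp only [Finset.mem_filter] at ha ⊢
      exact ⟨ha.1, hS a ha.1 i ha.2.1 ha.2.2, ha.2.2⟩
    have e2 : ((A.filter fun a => S i a).card : ℝ) ≤
        (A.filter fun a => S i a ∧ i < t a).card + (A.filter fun a => t a ≤ i ∧ i < n).card := by
      rw [← Nat.cast_add]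
      refine Nat.cast_le.2 ((Finset.card_le_card fun a ha => ?_).trans (Finset.card_union_le _ _))
      simp only [Finset.mem_union, Finset.mem_filter] at ha ⊢
      rcases lt_or_ge i (t a) with h | h
      exacts [.inl ⟨ha.1, ha.2, h⟩, .inr ⟨ha.1, h, hin⟩]
    -- If at most a third of the members of `S i` have `i < t a`, then these are at most half as
    -- many as the members with `t a ≤ i`.
    linarith [hfew i hin]
  rw [← Finset.mul_sum, h2] at h4
  rw [Finset.sum_sub_distrib] at h1
  linarith

/-! ### Crossing a strip with the help of one box -/

theorem ShortcutPath.cross_trivially {E : Set WEdge} {p : ℕ × ℕ} {x y y' w : ℕ} {C : ℝ}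
    (h : ShortcutPath E p (x, y) C) (hy : y ≤ y') :
    ShortcutPath E p (x + w, y') (C + w + (y' - y : ℕ)) := by
  have := (h.horiz_add w).vert_add (y' - y)
  rwa [Nat.add_sub_cancel' hy] at this

theorem ShortcutPath.cross_box {E : Set WEdge} {p : ℕ × ℕ} {y y' : ℕ} {C : ℝ} {b : WBox}
    (h : ShortcutPath E p (b.I.lo, y) C) (hb : shortcutEdges {b} ⊆ E) (hy : y ≤ b.J.lo)
    (hy' : b.J.hi ≤ y') :
    ShortcutPath E p (b.I.hi, y')
      (C + (b.J.lo - y : ℕ) + b.κ * b.I.width + (y' - b.J.hi : ℕ)) := by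
  have h1 := h.vert_add (b.J.lo - y)
  rw [Nat.add_sub_cancel' hy] at h1
  have h2 := (ShortcutPath.shortcut (p := p) (E := E)
    ⟨(b.I.lo, b.J.lo), (b.I.hi, b.J.hi), b.κ * b.I.width⟩ (hb ⟨b, rfl, rfl⟩) h1).vert_add
    (y' - b.J.hi)
  rwa [Nat.add_sub_cancel' hy'] at h2

/-- A box whose vertical interval is off by at most `ε_s w / 2` at both ends, together with the
boxes it induces, allows to cross the strip at extra cost at most `3 ε_s w`. -/
theorem ShortcutPath.cross_induced {E : Set WEdge} {p : ℕ × ℕ} {y y' m s : ℕ} {C κ : ℝ} {I J : Ivl}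
    (h : ShortcutPath E p (I.lo, y) C) (hE : shortcutEdges (induced {⟨I, J, κ⟩}) ⊆ E)
    (hI : I.width = 2 ^ m) (hJ : J.width = 2 ^ m)
    (hy : 2 * (Nat.dist y J.lo : ℝ) ≤ eps s * 2 ^ m)
    (hy' : 2 * (Nat.dist y' J.hi : ℝ) ≤ eps s * 2 ^ m) :
    ∃ C' ≤ C + (κ + 3 * eps s) * 2 ^ m, ShortcutPath E p (I.hi, y') C' := by
  rcases lt_or_ge s m with hs | hs
  · obtain ⟨r, rfl⟩ : ∃ r, m = s + r + 1 := ⟨m - s - 1, by omega⟩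
    have hr : eps s * 2 ^ (s + r + 1) = 2 * 2 ^ r := by
      rw [eps_natCast, pow_add, pow_add, one_div_pow]; field_simp
    rw [hr] at hy hy'
    have hy1 : Nat.dist y J.lo ≤ 2 ^ r := by exact_mod_cast (mul_le_mul_iff_right₀ two_pos).1 hy
    have hy2 : Nat.dist y' J.hi ≤ 2 ^ r := by exact_mod_cast (mul_le_mul_iff_right₀ two_pos).1 hy'
    have hrw : 2 * 2 ^ r ≤ J.width := by
      rw [hJ, ← pow_succ']; exact Nat.pow_le_pow_right two_pos (by omega)
    simp only [Nat.dist, Ivl.hi] at hy1 hy2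
    have hhi : (J.shrink (2 ^ r)).hi + 2 ^ r = J.hi := by
      simp only [Ivl.hi, Ivl.shrink]; omega
    have hpath := ShortcutPath.cross_box (y' := y') (b := ⟨I, J.shrink (2 ^ r), κ + 2 ^ (r + 1) / I.width⟩) h
      (Set.Subset.trans ?_ hE) ?_ ?_
    · refine ⟨_, ?_, hpath⟩
      have e1 : ((J.lo + 2 ^ r - y : ℕ) : ℝ) ≤ 2 * 2 ^ r := by
        exact_mod_cast (by omega : J.lo + 2 ^ r - y ≤ 2 * 2 ^ r)
      have e2 : ((y' - (J.shrink (2 ^ r)).hi : ℕ) : ℝ) ≤ 2 * 2 ^ r := by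
        have := hhi
        simp only [Ivl.hi] at this
        exact_mod_cast (by simp only [Ivl.hi]; omega : y' - (J.shrink (2 ^ r)).hi ≤ 2 * 2 ^ r)
      have e3 : (κ + 2 ^ (r + 1) / I.width) * (I.width : ℝ) = κ * 2 ^ (s + r + 1) + 2 * 2 ^ r := by
        rw [hI]; push_cast; field_simp; ring
      simp only [Ivl.shrink] at e1 e2 e3 ⊢
      rw [e3]
      linarith
    · rintro e ⟨b, rfl, rfl⟩
      refine ⟨_, .inr ⟨_, rfl, r, ?_, rfl⟩, rfl⟩
      simp only [hJ, Nat.log_pow one_lt_two]; omega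
    · simp only [Ivl.shrink]; omega
    · simp only [Ivl.hi] at hhi ⊢; omega
  -- At this scale the tolerance is below one unit, so the ends match exactly and the box itself is
  -- used.
  · have hle : eps s * 2 ^ m ≤ 1 := by
      rw [eps_natCast, one_div_pow, one_div_mul_eq_div]
      exact div_le_one_of_le₀ (pow_le_pow_right₀ one_le_two hs) (by positivity)
    have hz : ∀ k : ℕ, 2 * (k : ℝ) ≤ eps s * 2 ^ m → k = 0 := by
      intro k hk
      have : 2 * k ≤ 1 := by exact_mod_cast hk.trans hle
      omega
    obtain rfl : y = J.lo := Nat.eq_of_dist_eq_zero (hz _ hy)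
    obtain rfl : y' = J.hi := Nat.eq_of_dist_eq_zero (hz _ hy')
    have hpath := ShortcutPath.cross_box (b := ⟨I, J, κ⟩) h (Set.Subset.trans ?_ hE) le_rfl le_rfl
    · refine ⟨_, ?_, hpath⟩
      have := eps_pos s
      simp only [Nat.sub_self, Nat.cast_zero, add_zero, hI]
      push_cast
      have : 0 ≤ 3 * eps s * (2 : ℝ) ^ m := by positivity
      linarith
    · rintro e ⟨b, rfl, rfl⟩
      exact ⟨_, .inl rfl, rfl⟩

/-- The `a`-th interval of width `w` in `I`, counted from 0. -/
def Ivl.strip (I : Ivl) (w a : ℕ) : Ivl := ⟨I.lo + a * w, w⟩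

theorem Ivl.strip_hi (I : Ivl) (w a : ℕ) : (I.strip w a).hi = I.lo + (a + 1) * w := by
  simp only [Ivl.hi, Ivl.strip]; ring

/-- Prefixes and suffixes of the cut path keep each crossing within the height range of `J`, and the
cost of a prefix bounds the displacement. -/
theorem GridPath.strips_trans {z : List α} {w x M : ℕ} {h κ : ℕ → ℕ}
    (hall : ∀ a ≤ M, GridPath z (x + a * w, h a) (x + (a + 1) * w, h (a + 1)) (κ a))
    {a b : ℕ} (hab : a ≤ b) (hb : b ≤ M + 1) :
    GridPath z (x + a * w, h a) (x + b * w, h b) (∑ k ∈ Finset.Ico a b, κ k) := by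
  induction b, hab using Nat.le_induction with
  | base => simpa using GridPath.nil _
  | succ b hab ih =>
    rw [Finset.sum_Ico_succ_top hab]
    exact (ih (by omega)).trans (hall b (by omega))

/-- The accumulation of strip crossings along a shortcut path. -/
theorem exists_shortcutPath_strips {E : Set WEdge} {p : ℕ × ℕ} {w x M : ℕ} {h : ℕ → ℕ}
    {B : ℕ → ℝ} (h0 : ShortcutPath E p (x, h 0) 0)
    (hall : ∀ a ≤ M, ∀ C, ShortcutPath E p (x + a * w, h a) C →
      ∃ C' ≤ C + B a, ShortcutPath E p (x + (a + 1) * w, h (a + 1)) C') :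
    ∃ C ≤ ∑ a ∈ Finset.range (M + 1), B a, ShortcutPath E p (x + (M + 1) * w, h (M + 1)) C := by
  suffices H : ∀ b ≤ M + 1, ∃ C ≤ ∑ a ∈ Finset.range b, B a,
      ShortcutPath E p (x + b * w, h b) C from H _ le_rfl
  intro b hb
  induction b with
  | zero => exact ⟨0, by simp, by simpa using h0⟩
  | succ b ih =>
    obtain ⟨C, hC, hp⟩ := ih (by omega)
    obtain ⟨C', hC', hp'⟩ := hall b (by omega) C hp
    exact ⟨C', by rw [Finset.sum_range_succ]; linarith, hp'⟩

/-! ### Completeness of the approximate pattern match -/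

theorem mem_zoomIn {n i i' : ℕ} {I J I' J' : Ivl} :
    J' ∈ zoomIn n I J i I' i' ↔ J' ∈ epsAlignedIvls n I'.width (i' + 3) ∧ J'.Sub J ∧
      (boxDisplacement I' J' I J : ℝ) ≤ 2 * eps i * I.width := by
  classical
  exact Finset.mem_filter

/-- The square box at a strip, produced from a cheap crossing of the strip. -/
theorem exists_mem_zoomIn {z : List α} {n m m' L i s : ℕ} {I J : Ivl} {a y y' κ D : ℕ}
    (hI : I.width = 2 ^ m) (hJ : J ∈ epsAlignedIvls n (2 ^ m) (i + 3)) (hm : m' + L + 1 ≤ m)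
    (hi : i ≤ L) (hIz : I.hi ≤ z.length) (hz : z.length = 2 * n)
    (hstrip : (I.strip (2 ^ m') a).hi ≤ I.hi)
    (hp : GridPath z (I.lo + a * 2 ^ m', y) (I.lo + (a + 1) * 2 ^ m', y') κ)
    (hy : J.lo ≤ y) (hy' : y' ≤ J.hi)
    (hpre : GridPath z (I.lo, J.lo) (I.lo + a * 2 ^ m', y) D)
    (hD : ((D + κ : ℕ) : ℝ) ≤ eps i * 2 ^ m) (hκ : 4 * (κ : ℝ) ≤ eps s * 2 ^ m') :
    ∃ J' ∈ zoomIn n I J i (I.strip (2 ^ m') a) s, J'.width = 2 ^ m' ∧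
      ncost z (I.strip (2 ^ m') a) J' ≤ eps s ∧
      2 * (Nat.dist y J'.lo : ℝ) ≤ eps s * 2 ^ m' ∧
      2 * (Nat.dist y' J'.hi : ℝ) ≤ eps s * 2 ^ m' := by
  obtain ⟨hJw, hJa, hJn⟩ := mem_epsAlignedIvls.1 hJ
  rw [alignStep_two_pow] at hJa
  -- The widths differ by a factor of at least `2 ^ (L + 1)`, so the grid of `J` is coarser than
  -- that of the strip, and the ends of `J` can serve as the aligned range.
  have hdv : 2 ^ (m' - (s + 3)) ∣ J.lo := (pow_dvd_pow 2 (by omega)).trans hJa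
  have hdw : 2 ^ (m' - (s + 3)) ∣ J.hi := by
    unfold Ivl.hi
    rw [hJw]
    exact dvd_add hdv (pow_dvd_pow 2 (by omega))
  have hwle : 2 ^ m' ≤ 2 ^ m := Nat.pow_le_pow_right two_pos (by omega)
  have e : I.lo + (a + 1) * 2 ^ m' = I.lo + a * 2 ^ m' + 2 ^ m' := by ring
  rw [e] at hp
  obtain ⟨lo, h1, h2, h3, h4, h5, h6⟩ := hp.exists_aligned hdv hdw hy hy'
    (by unfold Ivl.hi; rw [hJw]; omega)
  have hmod := mod_two_pow_sub_le y m' (s + 3)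
  set q := y % 2 ^ (m' - (s + 3)) with hq
  -- In units of `ε_s w'`, the rounding error `q` is at most 1/8 and `κ` at most 1/4. So the ends
  -- are off by at most 3/8, below the allowed 1/2, and the box costs at most 2/4 + 2/8, below 1.
  have he8 : (2 : ℝ) ^ m' * eps ((s + 3 : ℕ) : ℤ) = eps s * 2 ^ m' / 8 := by
    push_cast; rw [eps_add]; norm_num [eps]; ring
  rw [he8] at hmod
  have hW : (0 : ℝ) < eps s * 2 ^ m' := mul_pos (eps_pos _) (by positivity)
  have h4' : (Nat.dist y lo : ℝ) ≤ κ + q := by exact_mod_cast h4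
  have h5' : (Nat.dist y' (lo + 2 ^ m') : ℝ) ≤ κ + q := by exact_mod_cast h5
  have h6' : (editd (seg z (I.lo + a * 2 ^ m') (I.lo + a * 2 ^ m' + 2 ^ m'))
    (seg z lo (lo + 2 ^ m')) : ℝ) ≤ 2 * κ + 2 * q := by exact_mod_cast h6
  refine ⟨⟨lo, 2 ^ m'⟩, ?_, rfl, ?_, ?_, ?_⟩
  · refine mem_zoomIn.2 ⟨mem_epsAlignedIvls.2 ⟨rfl, ?_, ?_⟩, ⟨h2, h3⟩, ?_⟩
    · simp only [Ivl.strip, alignStep_two_pow]; exact h1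
    · simp only [Ivl.hi] at h3 hJn ⊢; omega
    · have hd := hpre.displacement_le
      have hb : boxDisplacement (I.strip (2 ^ m') a) ⟨lo, 2 ^ m'⟩ I J ≤ D + κ + q := by
        simp only [boxDisplacement, Ivl.strip]
        simp only at hd
        simp only [Nat.dist] at h4
        rw [abs_le]
        omega
      have hb' : (boxDisplacement (I.strip (2 ^ m') a) ⟨lo, 2 ^ m'⟩ I J : ℝ) ≤ D + κ + q := by
        exact_mod_cast hb
      -- A strip is narrower than `ε_i w`, so the rounding error fits into the second `ε_i w`
      -- allowed for the displacement.
      have hle : eps s * 2 ^ m' ≤ eps i * 2 ^ m := by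
        have e1 : eps s ≤ 1 := by rw [← eps_zero]; exact eps_anti (by omega)
        have e2 : (1 : ℝ) * 2 ^ m' ≤ eps i * 2 ^ m := by
          rw [eps_natCast, one_div_pow, one_mul, one_div_mul_eq_div, le_div_iff₀ (by positivity),
            ← pow_add]
          exact pow_le_pow_right₀ one_le_two (by omega)
        exact le_trans (mul_le_mul_of_nonneg_right e1 (by positivity)) e2
      rw [hI]
      push_cast at hD ⊢
      linarith
  · rw [ncost_le_iff (by simp [Ivl.strip]), cost_eq_editd (hstrip.trans hIz), substr_eq_seg,
      substr_eq_seg, Ivl.strip_hi, e]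
    · simp only [Ivl.strip, Ivl.hi]
      push_cast
      linarith
    · simp only [Ivl.hi] at h3 hJn ⊢; omega
  · simp only; linarith
  · simp only [Ivl.hi]; linarith

open Classical in
/-- Completeness of the approximate pattern match: if at each index at most a third of the sparse
strips of `I` have a cheap box near the diagonal of `I × J`, then `J` is found. -/
theorem mem_APM_of_few {z : List α} {n m m' L c i : ℕ} {I J : Ivl} {R : Set WBox}
    {S : ℕ → Finset Ivl} (hI : I.width = 2 ^ m) (hJ : J ∈ epsAlignedIvls n (2 ^ m) (i + 3))
    (hm : m' + L + 1 ≤ m) (hi : i ≤ L) (hc : 2 ≤ c) (hIz : I.hi ≤ z.length)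
    (hz : z.length = 2 * n) (hcost : ncost z I J ≤ eps i)
    (hR0 : ∀ b ∈ R, 0 ≤ b.κ)
    (hR : ∀ s ≤ i, ∀ a < 2 ^ (m - m'), I.strip (2 ^ m') a ∉ S s →
      ∀ J' ∈ epsAlignedIvls n (2 ^ m') (s + 3), ncost z (I.strip (2 ^ m') a) J' ≤ eps s →
      induced {⟨I.strip (2 ^ m') a, J', eps ((s : ℤ) - c)⟩} ⊆ R)
    (hfew : ∀ s ≤ i, (((Finset.range (2 ^ (m - m'))).filter fun a => I.strip (2 ^ m') a ∈ S s ∧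
        ∃ J' ∈ zoomIn n I J i (I.strip (2 ^ m') a) s,
          ncost z (I.strip (2 ^ m') a) J' ≤ eps s).card : ℝ) ≤
      1 / 3 * ((Finset.range (2 ^ (m - m'))).filter fun a => I.strip (2 ^ m') a ∈ S s).card) :
    J ∈ APM I (epsAlignedIvls n (2 ^ m) (i + 3)) (eps ((i : ℤ) - c - 5)) R := by
  obtain ⟨hJw, hJa, hJn⟩ := mem_epsAlignedIvls.1 hJ
  obtain ⟨M, hM⟩ : ∃ M, 2 ^ (m - m') = M + 1 := ⟨2 ^ (m - m') - 1, by
    have := Nat.one_le_two_pow (n := m - m'); omega⟩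
  have hMw : (M + 1) * 2 ^ m' = 2 ^ m := by
    rw [← hM, ← pow_add]; congr 1; omega
  have hMw' : ((M : ℝ) + 1) * 2 ^ m' = 2 ^ m := by exact_mod_cast hMw
  rw [hM] at hR hfew
  have hpath := gridPath_cost z I J
  have hcost' := (ncost_le_iff (by rw [hI]; positivity)).1 hcost
  rw [hI] at hcost'
  push_cast at hcost'
  have hIhi : I.hi = I.lo + (M + 1) * 2 ^ m' := by rw [hMw, ← hI]; rfl
  rw [hIhi] at hpath
  obtain ⟨h, κ, h0, hlast, hsum, hall⟩ := GridPath.exists_strips M _ _ hpath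
  have hstripI : ∀ a ≤ M, (I.strip (2 ^ m') a).hi ≤ I.hi := by
    intro a ha
    rw [Ivl.strip_hi, hIhi]
    exact Nat.add_le_add_left (Nat.mul_le_mul_right _ (by omega)) _
  have key : ∀ a ≤ M, ∀ s ≤ i, 4 * (κ a : ℝ) ≤ eps s * 2 ^ m' →
      ∃ J' ∈ zoomIn n I J i (I.strip (2 ^ m') a) s, J'.width = 2 ^ m' ∧
      ncost z (I.strip (2 ^ m') a) J' ≤ eps s ∧
      2 * (Nat.dist (h a) J'.lo : ℝ) ≤ eps s * 2 ^ m' ∧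
      2 * (Nat.dist (h (a + 1)) J'.hi : ℝ) ≤ eps s * 2 ^ m' := by
    intro a ha s hs hκ
    have hpre := GridPath.strips_trans hall (Nat.zero_le a) (by omega)
    have hsuf := GridPath.strips_trans hall (a := a + 1) (b := M + 1) (by omega) le_rfl
    simp only [zero_mul, add_zero, h0, Nat.Ico_zero_eq_range] at hpre
    refine exists_mem_zoomIn hI hJ hm hi hIz hz (hstripI a ha) (hall a ha) hpre.le.2
      (by rw [← hlast]; exact hsuf.le.2) hpre ?_ hκ
    refine le_trans (Nat.cast_le.2 ?_) hcost'
    rw [← Finset.sum_range_succ, ← hsum]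
    exact Finset.sum_le_sum_of_subset (Finset.range_mono (by omega))
  -- The last scale at which strip `a` is cheap is `t a - 1`, and the last scale below `t a` at
  -- which it is not sparse is `s a - 1`; the value 0 means that there is none. On all of `[s a, t
  -- a)` the strip is both cheap and sparse.
  choose t ht ht1 ht2 using fun a =>
    exists_last_index (fun s => 4 * (κ a : ℝ) ≤ eps s * 2 ^ m') (i + 1)
  choose s hs hs1 hs2 using fun a => exists_last_index (fun l => I.strip (2 ^ m') a ∉ S l) (t a)
  have hcheap : ∀ a l, l < t a → 4 * (κ a : ℝ) ≤ eps l * 2 ^ m' := by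
    intro a l hl
    refine ((ht1 a).resolve_left (by omega)).trans
      (mul_le_mul_of_nonneg_right (eps_anti ?_) (by positivity))
    omega
  have hcount := sum_half_pow_le (Finset.range (M + 1)) (i + 1) s t
    (fun l a => I.strip (2 ^ m') a ∈ S l) (fun a _ => hs a) (fun a _ => ht a)
    (fun a _ l h1 h2 => not_not.1 (hs2 a l h1 h2)) (by
      intro l hl
      refine le_trans (Nat.cast_le.2 (Finset.card_le_card fun a ha => ?_))
        ((hfew l (by omega)).trans_eq (by congr!))
      simp only [Finset.mem_filter, Finset.mem_range] at ha ⊢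
      obtain ⟨J', hJ', -, hn, -⟩ := key a (by omega) l (by omega) (hcheap a l ha.2.2)
      exact ⟨ha.1, ha.2.1, J', hJ', hn⟩)
  -- If `t a ≤ i`, the strip is not cheap at scale `t a`, so the weight is below `4 κ a`. Otherwise
  -- `t a = i + 1` and it is `ε_i w' / 2`. Over all strips this gives 4 + 1/2 times `ε_i w`.
  have hsumt : ∑ a ∈ Finset.range (M + 1), (1 / 2 : ℝ) ^ t a * 2 ^ m' ≤
      9 / 2 * (eps i * 2 ^ m) := by
    have : ∀ a ∈ Finset.range (M + 1), (1 / 2 : ℝ) ^ t a * 2 ^ m' ≤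
        4 * κ a + eps i / 2 * 2 ^ m' := by
      intro a _
      have hκ0 : (0 : ℝ) ≤ κ a := Nat.cast_nonneg _
      rcases (ht a).lt_or_eq with h1 | h1
      · have h2 := not_le.1 (ht2 a (t a) le_rfl h1)
        rw [eps_natCast] at h2
        have := mul_pos (eps_pos i) (show (0 : ℝ) < 2 ^ m' by positivity)
        linarith
      · rw [h1, eps_natCast, pow_succ]
        linarith
    refine (Finset.sum_le_sum this).trans ?_
    rw [Finset.sum_add_distrib, ← Finset.mul_sum, ← Nat.cast_sum, hsum, Finset.sum_const,
      Finset.card_range, nsmul_eq_mul]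
    push_cast
    have : ((M : ℝ) + 1) * (eps i / 2 * 2 ^ m') = eps i * 2 ^ m / 2 := by rw [← hMw']; ring
    linarith
  rw [← Finset.sum_mul] at hsumt
  refine Finset.mem_filter.2 ⟨hJ, ?_⟩
  set E := shortcutEdges R ∪ freeEdges I (epsAlignedIvls n (2 ^ m) (i + 3)) with hE
  have hE0 : ∀ e ∈ E, 0 ≤ e.wt := by
    rintro e (⟨b, hb, rfl⟩ | ⟨J', -, rfl⟩)
    · exact mul_nonneg (hR0 b hb) (Nat.cast_nonneg _)
    · exact le_rfl
  have hstart : ShortcutPath E (I.lo, 0) (I.lo, h 0) 0 := by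
    rw [h0]
    have := ShortcutPath.shortcut (E := E) ⟨(I.lo, 0), (I.lo, J.lo), 0⟩ (.inr ⟨J, hJ, rfl⟩)
      (ShortcutPath.nil (I.lo, 0))
    simpa using this
  obtain ⟨C, hC, hCp⟩ := exists_shortcutPath_strips (M := M) (w := 2 ^ m')
    -- With `s a = l + 1` the first term is `(2 ^ c + 3) ε_l w'`, the price of crossing by a box of
    -- scale `l` and its induced boxes. With `s a = 0` it exceeds the `2 w'` needed, besides `κ a`,
    -- to cross without any box.
    (B := fun a => (2 ^ c + 3) * 2 * ((1 / 2 : ℝ) ^ s a * 2 ^ m') + κ a) hstart (by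
      intro a ha C hC
      have hκ0 : (0 : ℝ) ≤ κ a := Nat.cast_nonneg _
      have h2c : (1 : ℝ) ≤ 2 ^ c := one_le_pow₀ one_le_two
      rcases Nat.eq_zero_or_pos (s a) with h1 | h1
      · have hgp := hall a ha
        have hpos : 0 < 2 ^ m' := by positivity
        have hcross := hC.cross_trivially (w := 2 ^ m') hgp.le.2
        rw [add_assoc I.lo, ← add_one_mul] at hcross
        refine ⟨_, ?_, hcross⟩
        have hd := hgp.displacement_le.2
        have hd' : h (a + 1) - h a ≤ 2 ^ m' + κ a := by
          simp only [add_mul, one_mul] at hd; omega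
        have hd'' : ((h (a + 1) - h a : ℕ) : ℝ) ≤ 2 ^ m' + κ a := by exact_mod_cast hd'
        rw [h1, pow_zero]
        push_cast
        have : (0 : ℝ) < 2 ^ m' := by positivity
        nlinarith
      · obtain ⟨l, hl⟩ : ∃ l, s a = l + 1 := ⟨s a - 1, by omega⟩
        have hsl := hs a
        have htl := ht a
        obtain ⟨J', hJ', hw, hn, hd1, hd2⟩ := key a ha l (by omega) (hcheap a l (by omega))
        have hns : I.strip (2 ^ m') a ∉ S l := by
          have := (hs1 a).resolve_left (by omega)
          rwa [hl] at this
        have hsub := hR l (by omega) a (by omega) hns J' (mem_zoomIn.1 hJ').1 hn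
        have hsubE : shortcutEdges (induced {⟨I.strip (2 ^ m') a, J', eps ((l : ℤ) - c)⟩}) ⊆ E := by
          rintro e ⟨b, hb, rfl⟩
          exact .inl ⟨b, hsub hb, rfl⟩
        obtain ⟨C', hC', hp'⟩ := ShortcutPath.cross_induced (I := I.strip (2 ^ m') a) hC hsubE rfl
          hw hd1 hd2
        rw [Ivl.strip_hi] at hp'
        refine ⟨C', hC'.trans ?_, hp'⟩
        rw [eps_sub_natCast, eps_natCast, hl, pow_succ]
        nlinarith)
  rw [hlast, ← hIhi] at hCp
  refine (shortcutCost_le hE0 hCp).trans (hC.trans ?_)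
  rw [Finset.sum_add_distrib, ← Finset.mul_sum, ← Nat.cast_sum, hsum, ← Finset.sum_mul, hI]
  have e5 : eps ((i : ℤ) - c - 5) = 32 * (2 ^ c * eps i) := by
    rw [← eps_sub_natCast, show (i : ℤ) - c - 5 = (i : ℤ) - c - (5 : ℕ) by norm_num,
      eps_sub_natCast]
    norm_num
  rw [e5]
  push_cast
  -- In units of `ε_i w` the path costs at most `(2 ^ c + 3) * 2 * (27 / 4) + 1`, where 27/4 is 3/2
  -- times 9/2. This is at most `32 * 2 ^ c` once `c ≥ 2`.
  have h2c : (4 : ℝ) ≤ 2 ^ c := by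
    calc (4 : ℝ) = 2 ^ 2 := by norm_num
      _ ≤ 2 ^ c := pow_le_pow_right₀ one_le_two hc
  have hsums : (∑ a ∈ Finset.range (M + 1), (1 / 2 : ℝ) ^ s a) * 2 ^ m' ≤
      27 / 4 * (eps i * 2 ^ m) := by
    have := mul_le_mul_of_nonneg_right hcount (show (0 : ℝ) ≤ 2 ^ m' by positivity)
    linarith
  have hX : 0 < eps i * 2 ^ m := mul_pos (eps_pos _) (by positivity)
  have h3 := mul_le_mul_of_nonneg_left hsums (show (0 : ℝ) ≤ (2 ^ c + 3) * 2 by positivity)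
  have h4 := mul_le_mul_of_nonneg_right h2c hX.le
  linarith

/-! ### The parameters -/

namespace Params.Valid

variable {P : Params}

theorem two_le_n (hP : P.Valid) (hk : 1 ≤ P.k) : 2 ≤ P.n := by
  obtain ⟨a, ha⟩ := hP.w_pow P.k hk (Nat.le_succ _)
  have h1 := hP.w_lt P.k hk le_rfl
  have h2 : 1 ≤ 2 ^ a := Nat.one_le_two_pow
  rw [hP.w_last] at h1
  omega

theorem exists_width_pair (hP : P.Valid) {j : ℕ} (hj : 1 ≤ j) (hjk : j ≤ P.k) :
    ∃ m' m : ℕ, P.w j = 2 ^ m' ∧ P.w (j + 1) = 2 ^ m ∧ m' + P.L + 1 ≤ m := by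
  obtain ⟨m', hm'⟩ := hP.w_pow j hj (by omega)
  obtain ⟨m, hm⟩ := hP.w_pow (j + 1) (by omega) (by omega)
  refine ⟨m', m, hm', hm, ?_⟩
  have h := hP.w_ratio j hj hjk
  rw [hm', hm, Params.θ, one_div_pow] at h
  push_cast at h
  rw [div_div, div_le_div_iff₀ (by positivity) (by positivity), one_mul, ← pow_succ, ← pow_add] at h
  exact (pow_le_pow_iff_right₀ (one_lt_two (α := ℝ))).1 h

end Params.Valid

theorem Params.two_le_c (P : Params) {j : ℕ} (hj : 1 ≤ j) : 2 ≤ P.c j := by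
  obtain ⟨j, rfl⟩ := Nat.exists_eq_add_of_le' hj
  simp only [Params.c]
  omega

theorem Params.c_zero_le (P : Params) (j : ℕ) : P.c 0 ≤ P.c j := by
  induction j with
  | zero => exact le_rfl
  | succ j ih =>
    have : P.c (j + 1) = 3 * P.c j + 21 := rfl
    omega

/-- `c 0` is the rounded logarithm of `Q` and no later `c j` is smaller, so the error of the gap
subroutine is absorbed at every level. -/
theorem Params.Q_mul_eps_le (P : Params) (hQ : 1 ≤ P.Q) (i j : ℕ) :
    P.Q * eps i ≤ eps ((i : ℤ) - P.c j - 6) := by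
  have h1 : P.Q ≤ 2 ^ P.c 0 := by
    calc P.Q = (2 : ℝ) ^ Real.logb 2 P.Q :=
          (Real.rpow_logb two_pos (by norm_num) (by linarith)).symm
      _ ≤ (2 : ℝ) ^ (P.c 0 : ℝ) := Real.rpow_le_rpow_of_exponent_le one_le_two (Nat.le_ceil _)
      _ = 2 ^ P.c 0 := Real.rpow_natCast _ _
  calc P.Q * eps i ≤ 2 ^ P.c 0 * eps i := mul_le_mul_of_nonneg_right h1 (eps_pos _).le
    _ = eps ((i : ℤ) - P.c 0) := (eps_sub_natCast _ _).symm
    _ ≤ eps ((i : ℤ) - P.c j - 6) := eps_anti (by have := P.c_zero_le j; omega)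

theorem Params.mem_vIvls_mono {P : Params} {m j i i' : ℕ} (hw : P.w j = 2 ^ m) (h : i ≤ i')
    {J : Ivl} (hJ : J ∈ P.vIvls j i) : J ∈ P.vIvls j i' := by
  unfold Params.vIvls at *
  rw [mem_epsAlignedIvls, hw, alignStep_two_pow] at *
  exact ⟨hJ.1, (pow_dvd_pow 2 (by omega)).trans hJ.2.1, hJ.2.2⟩

/-- This makes the pairs `I₀ × I` of two horizontal intervals, from which `pivotX` is formed,
candidates at every index. -/
theorem Params.hIvls_subset_vIvls {P : Params} {m j : ℕ} (hw : P.w j = 2 ^ m) (i : ℕ) :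
    P.hIvls j ⊆ P.vIvls j i := by
  intro I hI
  unfold Params.hIvls Params.vIvls at *
  rw [mem_alignedIvls] at hI
  rw [mem_epsAlignedIvls]
  refine ⟨hI.1, ?_, by omega⟩
  rw [hw] at hI ⊢
  rw [alignStep_two_pow]
  exact (pow_dvd_pow 2 (Nat.sub_le _ _)).trans hI.2.1

/-! ### Costs of boxes over horizontal and vertical intervals -/

/-- For intervals inside a string, a bound on the normalized cost is one on the edit distance. -/
theorem ncost_le_iff_editd {z : List α} {I J : Ivl} {m : ℕ} {κ : ℝ} (hI : I.hi ≤ z.length)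
    (hJ : J.hi ≤ z.length) (hw : I.width = 2 ^ m) :
    ncost z I J ≤ κ ↔ (editd (substr z I) (substr z J) : ℝ) ≤ κ * 2 ^ m := by
  rw [ncost_le_iff (by rw [hw]; positivity), cost_eq_editd hI hJ, hw]
  push_cast
  rfl

theorem ncost_triangle {z : List α} {I₁ I₂ I₃ : Ivl} (h₁ : I₁.hi ≤ z.length)
    (h₂ : I₂.hi ≤ z.length) (h₃ : I₃.hi ≤ z.length) (hw : I₁.width = I₂.width) :
    ncost z I₁ I₃ ≤ ncost z I₁ I₂ + ncost z I₂ I₃ := by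
  unfold ncost
  rw [hw, ← add_div, cost_eq_editd h₁ h₂, cost_eq_editd h₂ h₃, cost_eq_editd h₁ h₃]
  gcongr
  exact_mod_cast editd_triangle _ _ _

theorem ncost_comm {z : List α} {I J : Ivl} (hI : I.hi ≤ z.length) (hJ : J.hi ≤ z.length)
    (hw : I.width = J.width) : ncost z I J = ncost z J I := by
  unfold ncost
  rw [hw, cost_eq_editd hI hJ, cost_eq_editd hJ hI, editd_comm]

theorem ncost_le_one {z : List α} {I J : Ivl} (h : J.width = I.width) : ncost z I J ≤ 1 := by
  refine div_le_one_of_le₀ ?_ (Nat.cast_nonneg _)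
  exact_mod_cast cost_le_width h

/-- Rounding an interval has little effect on the substring. -/
theorem ncost_roundDown_le {z : List α} {J : Ivl} {m s : ℕ} (hw : J.width = 2 ^ m)
    (hJ : J.hi ≤ z.length) :
    (roundDown J s).hi ≤ J.hi ∧ ncost z (roundDown J s) J ≤ 2 * eps s := by
  have hlo : (roundDown J s).lo + J.lo % 2 ^ (m - s) = J.lo := by
    simp only [roundDown, hw, alignStep_two_pow]
    exact Nat.div_add_mod' _ _
  have hhi : (roundDown J s).hi + J.lo % 2 ^ (m - s) = J.hi := by
    simp only [Ivl.hi] at hlo ⊢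
    have : (roundDown J s).width = J.width := rfl
    omega
  refine ⟨by omega, ?_⟩
  rw [ncost_le_iff_editd (I := roundDown J s) (m := m) (by omega) hJ hw, substr_eq_seg, substr_eq_seg]
  have h1 := editd_seg_dist z (roundDown J s).lo_le_hi J.lo_le_hi
  have h2 : editd (seg z (roundDown J s).lo (roundDown J s).hi) (seg z J.lo J.hi) ≤
      2 * (J.lo % 2 ^ (m - s)) := by
    simp only [Nat.dist] at h1
    omega
  have h3 := mod_two_pow_sub_le J.lo m s
  have h4 : (editd (seg z (roundDown J s).lo (roundDown J s).hi) (seg z J.lo J.hi) : ℝ) ≤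
      2 * (J.lo % 2 ^ (m - s) : ℕ) := by exact_mod_cast h2
  linarith

theorem roundDown_mem_vIvls {P : Params} {j i i' : ℕ} {J : Ivl}
    (hJ : J ∈ P.vIvls j i) : roundDown J (i' + 3) ∈ P.vIvls j i' := by
  obtain ⟨h1, -, h2⟩ := mem_epsAlignedIvls.1 hJ
  refine mem_epsAlignedIvls.2 ⟨h1, ?_, ?_⟩
  · simp only [roundDown, h1]; exact dvd_mul_left _ _
  · refine le_trans ?_ h2
    simp only [roundDown, Ivl.hi]
    have := Nat.div_mul_le_self J.lo (alignStep J.width (i' + 3))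
    omega

/-! ### Enumerate -/

section Enumerate

variable {P : Params} {acc : Ivl → Ivl → ℕ → Prop} {D : RunData}

theorem mem_enumerate_one {I J : Ivl} {Js : Finset Ivl} {i : ℕ} :
    J ∈ enumerate P acc D 1 I Js i ↔ J ∈ Js ∧ acc I J i := by
  classical
  simp [enumerate]

theorem mem_enumerate_add_two_iff {j : ℕ} {I J : Ivl} {Js : Finset Ivl} {i : ℕ} :
    J ∈ enumerate P acc D (j + 2) I Js i ↔ J ∈ Js ∧ (J ∈ D.bbelow (j + 2) I i ∨
      (J ∉ D.bbelow (j + 2) I i ∧ ∃ i' ≤ i, ∃ I' ∈ D.sample (j + 2) I i',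
        ∃ J' ∈ zoomIn P.n I J i I' i', J' ∈ enumerate P acc D (j + 1) I'
          ((Js \ (D.bbelow (j + 2) I i ∩ Js)).biUnion fun J₁ => zoomIn P.n I J₁ i I' i') i') ∧
      acc I J i) := by
  classical
  rw [enumerate]
  simp only [Finset.mem_union, Finset.mem_inter, Finset.mem_filter, Finset.mem_sdiff,
    Finset.Nonempty]
  by_cases hJ : J ∈ Js <;> by_cases hb : J ∈ D.bbelow (j + 2) I i <;> simp [hJ, hb]

theorem enumerate_subset (j : ℕ) (I : Ivl) (Js : Finset Ivl) (i : ℕ) :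
    enumerate P acc D j I Js i ⊆ Js := by
  intro J hJ
  match j with
  | 0 => simp [enumerate] at hJ
  | 1 => exact (mem_enumerate_one.1 hJ).1
  | j + 2 => exact (mem_enumerate_add_two_iff.1 hJ).1

/-- Consistency of Enumerate. -/
theorem mem_enumerate_iff {j : ℕ} : ∀ {I J : Ivl} {Js : Finset Ivl} {i : ℕ},
    J ∈ enumerate P acc D j I Js i ↔ J ∈ Js ∧ J ∈ enumerate P acc D j I {J} i := by
  induction j using Nat.strong_induction_on with
  | _ j ih =>
    intro I J Js i
    match j with
    | 0 => simp [enumerate]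
    | 1 => simp [mem_enumerate_one]
    | j + 2 =>
      rw [mem_enumerate_add_two_iff, mem_enumerate_add_two_iff]
      refine and_congr_right fun hJ => ?_
      simp only [Finset.mem_singleton, true_and]
      refine or_congr_right (and_congr_left fun _ => and_congr_right fun hb => ?_)
      -- The stack enters only through the recursive call. Since `J` is outside `bbelow`, it
      -- contributes its own zoomed intervals to that call, and by induction the answer on each of
      -- them does not depend on the others.
      have key : ∀ Ks : Finset Ivl, J ∈ Ks → ∀ (I' J' : Ivl) (i' : ℕ), J' ∈ zoomIn P.n I J i I' i' →
          (J' ∈ enumerate P acc D (j + 1) I'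
            ((Ks \ (D.bbelow (j + 2) I i ∩ Ks)).biUnion fun J₁ => zoomIn P.n I J₁ i I' i') i' ↔
          J' ∈ enumerate P acc D (j + 1) I' {J'} i') := by
        intro Ks hK I' J' i' hz
        rw [ih (j + 1) (by omega)]
        refine and_iff_right (Finset.mem_biUnion.2 ⟨J, ?_, hz⟩)
        exact Finset.mem_sdiff.2 ⟨hK, fun h => hb (Finset.mem_inter.1 h).1⟩
      refine exists_congr fun i' => and_congr_right fun _ => exists_congr fun I' =>
        and_congr_right fun _ => exists_congr fun J' => and_congr_right fun hz => ?_
      rw [key Js hJ I' J' i' hz, key {J} (Finset.mem_singleton_self J) I' J' i' hz]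

theorem isClose_iff {j : ℕ} {I J : Ivl} {i : ℕ} :
    IsClose P acc D j I J i ↔ J ∈ enumerate P acc D j I {J} i := by
  unfold IsClose
  constructor
  · intro h; rw [h]; exact Finset.mem_singleton_self J
  · intro h
    exact (enumerate_subset j I {J} i).antisymm (Finset.singleton_subset_iff.2 h)

theorem isFar_iff {j : ℕ} {I J : Ivl} {i : ℕ} :
    IsFar P acc D j I J i ↔ J ∉ enumerate P acc D j I {J} i := by
  unfold IsFar
  constructor
  · intro h; rw [h]; exact Finset.notMem_empty J
  · intro h
    refine Finset.eq_empty_of_forall_notMem fun J' hJ' => h ?_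
    obtain rfl := Finset.mem_singleton.1 (enumerate_subset j I {J} i hJ')
    exact hJ'

theorem mem_enumerate_iff_isClose {j : ℕ} {I J : Ivl} {Js : Finset Ivl} {i : ℕ} :
    J ∈ enumerate P acc D j I Js i ↔ J ∈ Js ∧ IsClose P acc D j I J i := by
  rw [mem_enumerate_iff, isClose_iff]

theorem isClose_one_iff {I J : Ivl} {i : ℕ} : IsClose P acc D 1 I J i ↔ acc I J i := by
  rw [isClose_iff, mem_enumerate_one]
  simp

theorem isClose_add_two_iff {j : ℕ} {I J : Ivl} {i : ℕ} :
    IsClose P acc D (j + 2) I J i ↔ J ∈ D.bbelow (j + 2) I i ∨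
      (∃ i' ≤ i, ∃ I' ∈ D.sample (j + 2) I i', ∃ J' ∈ zoomIn P.n I J i I' i',
        IsClose P acc D (j + 1) I' J' i') ∧ acc I J i := by
  rw [isClose_iff, mem_enumerate_add_two_iff]
  by_cases hb : J ∈ D.bbelow (j + 2) I i
  · simp [hb]
  · simp only [Finset.mem_singleton, true_and, hb, false_or, not_false_eq_true]
    refine and_congr_left fun _ => exists_congr fun i' => and_congr_right fun _ =>
      exists_congr fun I' => and_congr_right fun _ => exists_congr fun J' =>
        and_congr_right fun hz => ?_
    rw [mem_enumerate_iff_isClose]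
    refine and_iff_right (Finset.mem_biUnion.2 ⟨J, ?_, hz⟩)
    simp [hb]

end Enumerate

/-! ### The loop of ProcessDense -/

section DenseLoop

variable {P : Params} {acc : Ivl → Ivl → ℕ → Prop} {D : RunData}

/-- `I` lies in the set `X` of a pivot and has received the corresponding set `Y`. -/
def ReceivedFromPivot (P : Params) (acc : Ivl → Ivl → ℕ → Prop) (D : RunData) (j i : ℕ)
    (I : Ivl) (B : Finset Ivl) : Prop :=
  ∃ I₀ ∈ P.hIvls j, I ∈ pivotX P acc D j i I₀ ∧ B = pivotY P acc D j i I₀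

/-- The invariant of the loop of ProcessDense. -/
structure LoopState.Invariant (P : Params) (acc : Ivl → Ivl → ℕ → Prop) (D : RunData) (j i : ℕ)
    (s : LoopState) : Prop where
  todo_subset : s.todo ⊆ P.hIvls j
  covered : ∀ I ∈ P.hIvls j, I ∈ s.todo ∨ I ∈ s.sparse ∨
    ReceivedFromPivot P acc D j i I (s.bdense I)
  origin : ∀ I, s.bdense I = ∅ ∨ ReceivedFromPivot P acc D j i I (s.bdense I)

theorem LoopState.invariant_init (j i : ℕ) :
    (LoopState.init P j).Invariant P acc D j i :=
  ⟨subset_rfl, fun _ hI => .inl hI, fun _ => .inl rfl⟩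

theorem LoopState.Invariant.declareSparse {j i : ℕ} {s : LoopState}
    (h : s.Invariant P acc D j i) (I : Ivl) : (s.declareSparse I).Invariant P acc D j i := by
  refine ⟨Finset.sdiff_subset.trans h.todo_subset, fun I' hI' => ?_, h.origin⟩
  simp only [LoopState.declareSparse, Finset.mem_sdiff, Finset.mem_union, Finset.mem_singleton]
  have := h.covered I' hI'
  tauto

theorem LoopState.Invariant.usePivot {j i : ℕ} {s : LoopState}
    (h : s.Invariant P acc D j i) {I : Ivl} (hI : I ∈ s.todo) :
    (s.usePivot I (pivotX P acc D j i I) (pivotY P acc D j i I)).Invariant P acc D j i := by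
  have hnew : ∀ I', I' ∈ pivotX P acc D j i I →
      ReceivedFromPivot P acc D j i I' (pivotY P acc D j i I) :=
    fun I' hX => ⟨I, h.todo_subset hI, hX, rfl⟩
  refine ⟨Finset.sdiff_subset.trans h.todo_subset, fun I' hI' => ?_, fun I' => ?_⟩
  all_goals
    simp only [LoopState.usePivot, Finset.mem_sdiff]
    by_cases hX : I' ∈ pivotX P acc D j i I
    · simp only [if_pos hX]
      tauto
    simp only [hX, not_false_eq_true, and_true, if_false]
  · exact h.covered I' hI'
  · exact h.origin I'

theorem DenseLoop.invariant {j i : ℕ} {s s' : LoopState} (hl : DenseLoop P acc D j i s s') :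
    s.Invariant P acc D j i → s'.Invariant P acc D j i ∧ s'.todo = ∅ := by
  induction hl with
  | done s h => exact fun hs => ⟨hs, h⟩
  | sparse s s' I S _ _ _ _ ih => exact fun hs => ih (hs.declareSparse I)
  | dense s s' I S hI _ _ _ ih => exact fun hs => ih (hs.usePivot hI)

/-- This is the `origin` part of the loop invariant: a nonempty set was handed out by some pivot. It
serves soundness. -/
theorem ProcessDenseAt.mem_bdense {j i : ℕ} (h : ProcessDenseAt P acc D j) (hi : i ≤ P.L)
    (hic : P.c j < i) {I J : Ivl} (hI : I ∈ P.hIvls j) (hJ : J ∈ D.bdense j I i) :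
    ∃ I₀ ∈ P.hIvls j, I ∈ pivotX P acc D j i I₀ ∧ J ∈ pivotY P acc D j i I₀ := by
  have h := h i hi
  rw [if_neg (not_le.2 hic)] at h
  obtain ⟨s, hs, -, -, hb⟩ := h
  rw [hb I hI] at hJ
  rcases (hs.invariant (LoopState.invariant_init j i)).1.origin I with h0 | ⟨I₀, h1, h2, h3⟩
  · simp [h0] at hJ
  · exact ⟨I₀, h1, h2, h3 ▸ hJ⟩

/-- When the loop ends nothing is left to do, so by the `covered` part of the invariant an interval
that is not sparse was served by a pivot. It serves completeness. -/
theorem ProcessDenseAt.bdense_eq {j i : ℕ} (h : ProcessDenseAt P acc D j) (hi : i ≤ P.L)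
    (hic : P.c j < i) {I : Ivl} (hI : I ∈ P.hIvls j) (hs : I ∉ D.sparse j i) :
    ∃ I₀ ∈ P.hIvls j, I ∈ pivotX P acc D j i I₀ ∧ D.bdense j I i = pivotY P acc D j i I₀ := by
  have h := h i hi
  rw [if_neg (not_le.2 hic)] at h
  obtain ⟨s, hl, hsp, -, hb⟩ := h
  obtain ⟨hinv, hempty⟩ := hl.invariant (LoopState.invariant_init j i)
  rw [hb I hI]
  rcases hinv.covered I hI with h1 | h1 | h1
  · simp [hempty] at h1
  · exact absurd (hsp ▸ h1) hs
  · exact h1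

theorem ProcessDenseAt.bdense_eq_vIvls {j i : ℕ} (h : ProcessDenseAt P acc D j) (hi : i ≤ P.L)
    (hic : i ≤ P.c j) {I : Ivl} (hI : I ∈ P.hIvls j) : D.bdense j I i = P.vIvls j i := by
  have h := h i hi
  rw [if_pos hic] at h
  exact h.2.2 I hI

theorem ProcessDenseAt.bdense_subset {j i : ℕ} (h : ProcessDenseAt P acc D j) (hi : i ≤ P.L)
    {I : Ivl} (hI : I ∈ P.hIvls j) : D.bdense j I i ⊆ P.vIvls j i := by
  rcases le_or_gt i (P.c j) with hic | hic
  · rw [h.bdense_eq_vIvls hi hic hI]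
  · intro J hJ
    obtain ⟨I₀, -, -, hY⟩ := h.mem_bdense hi hic hI hJ
    exact (Finset.mem_filter.1 hY).1

end DenseLoop

/-! ### Weighted boxes -/

theorem induced_mono {Q Q' : Set WBox} (h : Q ⊆ Q') : induced Q ⊆ induced Q' := by
  rintro b (hb | ⟨a, ha, hb⟩)
  exacts [.inl (h hb), .inr ⟨a, h ha, hb⟩]

theorem induced_I_eq {B b : WBox} (h : b ∈ induced {B}) : b.I = B.I := by
  rcases h with rfl | ⟨a, rfl, s, -, rfl⟩ <;> rfl

/-- Shrinking the vertical interval of a certified square box gives a certified box. -/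
theorem induced_certified {z : List α} {Q : Set WBox} (hpos : ∀ b ∈ Q, 0 < b.I.width)
    (hIz : ∀ b ∈ Q, b.I.hi ≤ z.length) (hJz : ∀ b ∈ Q, b.J.hi ≤ z.length)
    (hQ : ∀ b ∈ Q, b.Certified z) :
    ∀ b ∈ induced Q, b.Certified z := by
  rintro b (hb | ⟨a, ha, s, hs, rfl⟩)
  · exact hQ b hb
  · have hw := hpos a ha
    have hw' : (0 : ℝ) < a.I.width := Nat.cast_pos.2 hw
    have hlen : 2 * 2 ^ s ≤ a.J.width := by
      rw [← pow_succ']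
      refine (Nat.pow_le_pow_right two_pos hs).trans (Nat.pow_log_le_self 2 ?_)
      rintro h
      simp [h] at hs
    have hc : (cost z a.I a.J : ℝ) ≤ a.κ * a.I.width := (ncost_le_iff hw).1 (hQ a ha)
    have hhi : (a.J.shrink (2 ^ s)).hi + 2 ^ s = a.J.hi := by
      simp only [Ivl.hi, Ivl.shrink]; omega
    unfold WBox.Certified
    rw [ncost_le_iff hw, cost_eq_editd (hIz a ha)]
    · rw [cost_eq_editd (hIz a ha) (hJz a ha)] at hc
      have h1 := editd_triangle (substr z a.I) (substr z a.J) (substr z (a.J.shrink (2 ^ s)))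
      have h2 := editd_seg_dist z a.J.lo_le_hi (a.J.shrink (2 ^ s)).lo_le_hi
      rw [← substr_eq_seg, ← substr_eq_seg] at h2
      -- Both ends move by `2 ^ s`, which is what the additional weight `2 ^ (s + 1) / μ(I)` pays
      -- for; by `hlen` the subtraction in `shrink` is not truncated.
      have h3 : Nat.dist a.J.lo (a.J.shrink (2 ^ s)).lo +
          Nat.dist a.J.hi (a.J.shrink (2 ^ s)).hi = 2 * 2 ^ s := by
        have : (a.J.shrink (2 ^ s)).lo = a.J.lo + 2 ^ s := rfl
        simp only [Nat.dist]
        omega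
      have h4 : (editd (substr z a.I) (substr z (a.J.shrink (2 ^ s))) : ℝ) ≤
          editd (substr z a.I) (substr z a.J) + 2 * 2 ^ s := by
        exact_mod_cast (by omega : editd (substr z a.I) (substr z (a.J.shrink (2 ^ s))) ≤
          editd (substr z a.I) (substr z a.J) + 2 * 2 ^ s)
      rw [add_mul, div_mul_cancel₀ _ hw'.ne', pow_succ']
      linarith
    · have := hJz a ha
      simp only
      omega

/-! ### The properties of one level -/

section Level

variable {P : Params} {z : List α} {acc : Ivl → Ivl → ℕ → Prop} {D : RunData}

theorem Params.width_hIvls {j : ℕ} {I : Ivl} (hI : I ∈ P.hIvls j) : I.width = P.w j :=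
  (mem_alignedIvls.1 hI).1

theorem Params.width_vIvls {j i : ℕ} {J : Ivl} (hJ : J ∈ P.vIvls j i) : J.width = P.w j :=
  (mem_epsAlignedIvls.1 hJ).1

theorem Params.hi_hIvls {j : ℕ} {I : Ivl} (hI : I ∈ P.hIvls j) (hz : z.length = 2 * P.n) :
    I.hi ≤ z.length := by
  have := (mem_alignedIvls.1 hI).2.2
  omega

theorem Params.hi_vIvls {j i : ℕ} {J : Ivl} (hJ : J ∈ P.vIvls j i) (hz : z.length = 2 * P.n) :
    J.hi ≤ z.length := by
  have := (mem_epsAlignedIvls.1 hJ).2.2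
  omega

/-- Correctness of the calls of the gap subroutine at level `j`. -/
structure AcceptsCorrectly (P : Params) (z : List α) (acc : Ivl → Ivl → ℕ → Prop) (j : ℕ) :
    Prop where
  accept : ∀ i ≤ P.L, ∀ I ∈ P.hIvls j, ∀ J ∈ P.vIvls j i,
    ncost z I J ≤ eps i → acc I J i
  reject : ∀ i ≤ P.L, ∀ I ∈ P.hIvls j, ∀ J ∈ P.vIvls j i,
    acc I J i → ncost z I J ≤ P.Q * eps i

/-- The statements about level `j` which the next level uses. -/
structure LevelCorrect (P : Params) (z : List α) (acc : Ivl → Ivl → ℕ → Prop) (D : RunData)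
    (j : ℕ) : Prop where
  isClose_of_ncost_le : ∀ i ≤ P.L, ∀ I ∈ P.hIvls j, ∀ J ∈ P.vIvls j i,
    ncost z I J ≤ eps i → IsClose P acc D j I J i
  bdense_sound : ∀ i ≤ P.L, ∀ I ∈ P.hIvls j, ∀ J ∈ D.bdense j I i,
    J ∈ P.vIvls j i ∧ ncost z I J ≤ eps ((i : ℤ) - P.c j)
  bdense_complete : ∀ i ≤ P.L, ∀ I ∈ P.hIvls j, I ∉ D.sparse j i → ∀ J ∈ P.vIvls j i,
    ncost z I J ≤ eps i → J ∈ D.bdense j I i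

theorem boxesR_width_pos {m j : ℕ} (hw : P.w j = 2 ^ m) {b : WBox} (hb : b ∈ boxesR P D j) :
    0 < b.I.width := by
  have : ∀ b ∈ boxesQ P D j, 0 < b.I.width := by
    rintro b ⟨i, -, I, hI, J, -, rfl⟩
    simp only [Params.width_hIvls hI, hw]
    positivity
  rcases hb with hb | ⟨a, ha, s, -, rfl⟩
  exacts [this b hb, this a ha]

theorem boxesR_weight_nonneg {j : ℕ} {b : WBox} (hb : b ∈ boxesR P D j) : 0 ≤ b.κ := by
  have : ∀ b ∈ boxesQ P D j, 0 ≤ b.κ := by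
    rintro b ⟨i, -, I, hI, J, -, rfl⟩
    exact (eps_pos _).le
  rcases hb with hb | ⟨a, ha, s, -, rfl⟩
  · exact this b hb
  · have := this a ha
    simp only
    positivity

theorem LevelCorrect.boxesR_certified {j m : ℕ} (h : LevelCorrect P z acc D j)
    (hw : P.w j = 2 ^ m) (hz : z.length = 2 * P.n) :
    ∀ b ∈ boxesR P D j, b.Certified z := by
  refine induced_certified ?_ ?_ ?_ ?_
  · exact fun b hb => boxesR_width_pos hw (.inl hb)
  all_goals rintro b ⟨i, hi, I, hI, J, hJ, rfl⟩
  · exact Params.hi_hIvls hI hz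
  · exact Params.hi_vIvls (h.bdense_sound i hi I hI J hJ).1 hz
  · exact (h.bdense_sound i hi I hI J hJ).2

/-- The factor 2 lost by the pattern match turns its threshold index `i - c_{j-1} - 5` into `i -
c_{j-1} - 6`. -/
theorem ncost_le_of_mem_bbelow {j i m : ℕ} {I J : Ivl} (hpre : PreprocessAt P D j) (hi : i ≤ P.L)
    (hI : I ∈ P.hIvls j) (hw : P.w j = 2 ^ m) (hz : z.length = 2 * P.n)
    (hR : j ≠ 1 → ∀ b ∈ boxesR P D (j - 1), 0 < b.I.width ∧ b.Certified z)
    (hJ : J ∈ D.bbelow j I i) :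
    ncost z I J ≤ eps ((i : ℤ) - P.c (j - 1) - 6) := by
  have h := hpre i hi I hI
  split_ifs at h with hj
  · simp [h.2] at hJ
  · rw [h.2.2] at hJ
    have hJv : J ∈ P.vIvls j i := (Finset.mem_filter.1 hJ).1
    refine (ncost_le_of_mem_APM (fun b hb => hR hj b hb.1) ?_ (Params.hi_hIvls hI hz)
      (Params.hi_vIvls hJv hz) ?_ hJ).trans_eq ?_
    · rw [Params.width_hIvls hI, hw]; positivity
    · rw [Params.width_hIvls hI, Params.width_vIvls hJv]
    · rw [eps_add_one ((i : ℤ) - P.c (j - 1) - 6)]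
      congr 2
      ring

/-- A CLOSE candidate either lies in `bbelow` or was accepted by the gap subroutine. Sampling
decides only which candidates are submitted, so it cannot harm soundness. -/
theorem ncost_le_of_isClose {j i m : ℕ} {I J : Ivl} (hj : 1 ≤ j) (hpre : PreprocessAt P D j)
    (hi : i ≤ P.L) (hI : I ∈ P.hIvls j) (hJ : J ∈ P.vIvls j i) (hw : P.w j = 2 ^ m)
    (hz : z.length = 2 * P.n) (hQ : 1 ≤ P.Q)
    (hR : j ≠ 1 → ∀ b ∈ boxesR P D (j - 1), 0 < b.I.width ∧ b.Certified z)
    (hacc : AcceptsCorrectly P z acc j) (hc : IsClose P acc D j I J i) :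
    ncost z I J ≤ eps ((i : ℤ) - P.c (j - 1) - 6) := by
  have hcall : acc I J i → ncost z I J ≤ eps ((i : ℤ) - P.c (j - 1) - 6) := fun h =>
    (hacc.reject i hi I hI J hJ h).trans (P.Q_mul_eps_le hQ i _)
  match j, hj with
  | 1, _ => exact hcall (isClose_one_iff.1 hc)
  | j + 2, _ =>
    rcases isClose_add_two_iff.1 hc with h | ⟨-, h⟩
    · exact ncost_le_of_mem_bbelow hpre hi hI hw hz hR h
    · exact hcall h

/-- Together with the converse below this identifies the aligned subintervals of `I` with its
strips, so that cardinalities in `winners` and `sparseIn` become counts of strip indices. -/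
theorem strip_mem_alignedIvlsIn {j m m' a : ℕ} {I : Ivl} (hI : I ∈ P.hIvls (j + 1))
    (hw' : P.w j = 2 ^ m') (hw : P.w (j + 1) = 2 ^ m) (hm : m' ≤ m) (ha : a < 2 ^ (m - m')) :
    I.strip (2 ^ m') a ∈ alignedIvlsIn P.n (P.w j) I := by
  classical
  obtain ⟨h1, h2, h3⟩ := mem_alignedIvls.1 hI
  have hhi : (I.strip (2 ^ m') a).hi ≤ I.hi := by
    rw [Ivl.strip_hi]
    unfold Ivl.hi
    rw [h1, hw]
    calc I.lo + (a + 1) * 2 ^ m' ≤ I.lo + 2 ^ (m - m') * 2 ^ m' := by gcongr; omega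
      _ = I.lo + 2 ^ m := by rw [← pow_add, Nat.sub_add_cancel hm]
  refine Finset.mem_filter.2 ⟨mem_alignedIvls.2 ⟨hw'.symm, ?_, hhi.trans h3⟩, ?_, hhi⟩
  · rw [hw']
    rw [hw] at h2
    exact dvd_add ((pow_dvd_pow 2 hm).trans h2) (dvd_mul_left _ _)
  · exact Nat.le_add_right _ _

theorem exists_strip_of_mem_alignedIvlsIn {j m m' : ℕ} {I I' : Ivl} (hI : I ∈ P.hIvls (j + 1))
    (hw' : P.w j = 2 ^ m') (hw : P.w (j + 1) = 2 ^ m) (hm : m' ≤ m)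
    (h : I' ∈ alignedIvlsIn P.n (P.w j) I) :
    ∃ a < 2 ^ (m - m'), I' = I.strip (2 ^ m') a := by
  classical
  obtain ⟨h1, h2, h3⟩ := mem_alignedIvls.1 hI
  obtain ⟨h4, h5, h6⟩ := Finset.mem_filter.1 h
  obtain ⟨h7, h8, h9⟩ := mem_alignedIvls.1 h4
  rw [hw] at h1 h2
  rw [hw'] at h7 h8
  obtain ⟨a, ha⟩ := Nat.dvd_sub h8 ((pow_dvd_pow 2 hm).trans h2)
  have hlo : I'.lo = I.lo + a * 2 ^ m' := by rw [mul_comm, ← ha]; omega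
  refine ⟨a, ?_, ?_⟩
  · have hpow : 2 ^ (m - m') * 2 ^ m' = 2 ^ m := by rw [← pow_add, Nat.sub_add_cancel hm]
    unfold Ivl.hi at h6
    rw [h1, h7, hlo, ← hpow] at h6
    have : (a + 1) * 2 ^ m' ≤ 2 ^ (m - m') * 2 ^ m' := by rw [add_mul, one_mul]; omega
    exact Nat.le_of_mul_le_mul_right this (by positivity)
  · cases I'
    simp only at hlo h7
    rw [hlo, h7]
    rfl

theorem strip_injective (I : Ivl) {w : ℕ} (hw : 0 < w) : Function.Injective (I.strip w) := by
  intro a b h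
  have : I.lo + a * w = I.lo + b * w := congrArg Ivl.lo h
  exact Nat.eq_of_mul_eq_mul_right hw (by omega)

theorem mem_winners {j i i' : ℕ} {I J I' : Ivl} :
    I' ∈ winners P acc D j I J i i' ↔ I' ∈ sparseIn P D j I i' ∧
      ∃ J' ∈ zoomIn P.n I J i I' i', IsClose P acc D (j - 1) I' J' i' := by
  classical
  exact Finset.mem_filter

/-- Completeness of `Bbelow`. -/
theorem mem_bbelow_or_many_winners {j i : ℕ} {I J : Ivl} (hP : P.Valid) (hj : 1 ≤ j)
    (hjk : j ≤ P.k) (hpre : PreprocessAt P D (j + 1)) (hi : i ≤ P.L) (hI : I ∈ P.hIvls (j + 1))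
    (hJ : J ∈ P.vIvls (j + 1) i) (hz : z.length = 2 * P.n)
    (hprev : LevelCorrect P z acc D j) (hcost : ncost z I J ≤ eps i) :
    J ∈ D.bbelow (j + 1) I i ∨ ∃ i' ≤ i, (1 / 3 : ℝ) * (sparseIn P D (j + 1) I i').card <
      (winners P acc D (j + 1) I J i i').card := by
  classical
  obtain ⟨m', m, hw', hw, hm⟩ := hP.exists_width_pair hj hjk
  by_contra! hcon
  obtain ⟨hnot, hfew⟩ := hcon
  refine hnot ?_
  have h := hpre i hi I hI
  rw [if_neg (by omega : j + 1 ≠ 1)] at h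
  rw [h.2.2, Nat.add_sub_cancel]
  unfold Params.vIvls at hJ ⊢
  rw [hw] at hJ ⊢
  have hstrip : ∀ a < 2 ^ (m - m'), I.strip (2 ^ m') a ∈ alignedIvlsIn P.n (P.w j) I :=
    fun a ha => strip_mem_alignedIvlsIn hI hw' hw (by omega) ha
  have hstrip' : ∀ a < 2 ^ (m - m'), I.strip (2 ^ m') a ∈ P.hIvls j :=
    fun a ha => (Finset.mem_filter.1 (hstrip a ha)).1
  have hvI : ∀ s J', J' ∈ epsAlignedIvls P.n (2 ^ m') (s + 3) ↔ J' ∈ P.vIvls j s := by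
    intro s J'
    unfold Params.vIvls
    rw [hw']
  refine mem_APM_of_few (S := fun l => D.sparse j l) ((Params.width_hIvls hI).trans hw) hJ hm hi
    (P.two_le_c hj) (Params.hi_hIvls hI hz) hz hcost (fun b hb => boxesR_weight_nonneg hb.1) ?_ ?_
  · intro s hs a ha hns J' hJ' hn b hb
    have hQ : (⟨I.strip (2 ^ m') a, J', eps ((s : ℤ) - P.c j)⟩ : WBox) ∈ boxesQ P D j :=
      ⟨s, by omega, _, hstrip' a ha, J', hprev.bdense_complete s (by omega) _ (hstrip' a ha) hns J'
        ((hvI s J').1 hJ') hn, rfl⟩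
    refine ⟨induced_mono (Set.singleton_subset_iff.2 hQ) hb, ?_⟩
    rw [induced_I_eq hb]
    exact (Finset.mem_filter.1 (hstrip a ha)).2
  · intro s hs
    -- Completeness of Enumerate at the previous level makes every sparse strip with a cheap nearby
    -- box a winner.
    refine le_trans ?_ ((hfew s hs).trans ?_)
    · rw [← Finset.card_image_of_injective _ (strip_injective I (Nat.two_pow_pos m'))]
      refine Nat.cast_le.2 (Finset.card_le_card fun I' hI' => ?_)
      obtain ⟨a, ha, rfl⟩ := Finset.mem_image.1 hI'
      simp only [Finset.mem_filter, Finset.mem_range] at ha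
      obtain ⟨ha, hsp, J', hJ', hn⟩ := ha
      refine mem_winners.2 ⟨Finset.mem_inter.2 ⟨hstrip a ha, hsp⟩, J', hJ', ?_⟩
      exact hprev.isClose_of_ncost_le s (by omega) _ (hstrip' a ha) J'
        ((hvI s J').1 (mem_zoomIn.1 hJ').1) hn
    · refine mul_le_mul_of_nonneg_left (Nat.cast_le.2 ?_) (by norm_num)
      refine (Finset.card_le_card fun I' hI' => ?_).trans
        (Finset.card_image_le (f := I.strip (2 ^ m')))
      obtain ⟨h1, h2⟩ := Finset.mem_inter.1 hI'
      obtain ⟨a, ha, rfl⟩ := exists_strip_of_mem_alignedIvlsIn hI hw' hw (by omega) h1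
      exact Finset.mem_image_of_mem _ (Finset.mem_filter.2 ⟨Finset.mem_range.2 ha, h2⟩)

/-- Completeness of Enumerate. -/
theorem isClose_of_ncost_le {ζ : ℝ} {j i : ℕ} {I J : Ivl} (hP : P.Valid) (hj : 1 ≤ j)
    (hjk : j ≤ P.k) (hpre : PreprocessAt P D j) (hi : i ≤ P.L) (hI : I ∈ P.hIvls j)
    (hJ : J ∈ P.vIvls j i) (hz : z.length = 2 * P.n) (hacc : AcceptsCorrectly P z acc j)
    (hSR : SuccessfulRandomization P ζ z acc D)
    (hprev : j ≠ 1 → LevelCorrect P z acc D (j - 1)) (hcost : ncost z I J ≤ eps i) :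
    IsClose P acc D j I J i := by
  have hcall := hacc.accept i hi I hI J hJ hcost
  match j, hj with
  | 1, _ => exact isClose_one_iff.2 hcall
  | j + 2, _ =>
    refine isClose_add_two_iff.2 ?_
    refine (mem_bbelow_or_many_winners hP (by omega) (by omega) hpre hi hI hJ hz
      (hprev (by omega)) hcost).imp_right ?_
    rintro ⟨i', hi', hmany⟩
    refine ⟨⟨i', hi', ?_⟩, hcall⟩
    have hsub : winners P acc D (j + 2) I J i i' ⊆ sparseIn P D (j + 2) I i' :=
      fun _ h => (mem_winners.1 h).1
    -- The strict inequality excludes an empty set of sparse intervals, from which nothing would be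
    -- sampled.
    have hne : (sparseIn P D (j + 2) I i').Nonempty := by
      refine Finset.Nonempty.mono hsub (Finset.card_pos.1 (Nat.cast_pos.1 (lt_of_le_of_lt ?_ hmany)))
      positivity
    obtain ⟨I', h1, h2⟩ := hSR.sample_hits (j + 2) (by omega) hjk i hi I hI J hJ i' hi' hne
      (by linarith)
    exact ⟨I', h1, (mem_winners.1 h2).2⟩

/-- Soundness of `Bdense`. -/
theorem ncost_le_of_mem_bdense {j i m : ℕ} {I J : Ivl} (hj : 1 ≤ j) (hw : P.w j = 2 ^ m)
    (hd : ProcessDenseAt P acc D j) (hi : i ≤ P.L) (hI : I ∈ P.hIvls j) (hz : z.length = 2 * P.n)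
    (hclose : ∀ i ≤ P.L, ∀ I ∈ P.hIvls j, ∀ J ∈ P.vIvls j i, IsClose P acc D j I J i →
      ncost z I J ≤ eps ((i : ℤ) - P.c (j - 1) - 6))
    (hJ : J ∈ D.bdense j I i) : ncost z I J ≤ eps ((i : ℤ) - P.c j) := by
  have hJv := hd.bdense_subset hi hI hJ
  rcases le_or_gt i (P.c j) with hic | hic
  · refine (ncost_le_one ?_).trans ?_
    · rw [Params.width_hIvls hI, Params.width_vIvls hJv]
    · rw [← eps_zero]; exact eps_anti (by omega)
  · obtain ⟨I₀, hI₀, hX, hY⟩ := hd.mem_bdense hi hic hI hJ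
    obtain ⟨j, rfl⟩ := Nat.exists_eq_add_of_le' hj
    have hc : P.c (j + 1) = 3 * P.c j + 21 := rfl
    simp only [pivotX, pivotY, Finset.mem_filter, Nat.add_sub_cancel] at hX hY hclose
    set h₁ := i - P.c j - 7 with hh₁
    set h₂ := i - 2 * P.c j - 14 with hh₂
    obtain ⟨-, hXc⟩ := mem_enumerate_iff_isClose.1 hX
    obtain ⟨hRv, hYc⟩ := mem_enumerate_iff_isClose.1 hY.2
    have hIv := Params.hIvls_subset_vIvls hw h₁ hI
    have e1 := hclose h₁ (by omega) I₀ hI₀ I hIv hXc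
    have e2 := hclose h₂ (by omega) I₀ hI₀ _ hRv hYc
    have e3 := (ncost_roundDown_le (z := z) (s := h₂ + 3) ((Params.width_vIvls hJv).trans hw)
      (Params.hi_vIvls hJv hz)).2
    have hIz := Params.hi_hIvls hI hz
    have hI₀z := Params.hi_hIvls hI₀ hz
    have hRz := Params.hi_vIvls hRv hz
    have hJz := Params.hi_vIvls hJv hz
    have hwI : I.width = P.w (j + 1) := Params.width_hIvls hI
    have hwI₀ : I₀.width = P.w (j + 1) := Params.width_hIvls hI₀
    have hwR := Params.width_vIvls hRv
    have t1 := ncost_triangle hIz hI₀z hJz (hwI.trans hwI₀.symm)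
    have t2 := ncost_triangle hI₀z hRz hJz (hwI₀.trans hwR.symm)
    rw [ncost_comm hIz hI₀z (hwI.trans hwI₀.symm)] at t1
    -- In units of the target bound, the way from `I` to the pivot, on to the rounded interval and
    -- on to `J` costs at most 1/4 + 1/2 + 2/8 = 1. The second index bound is an equality, which
    -- accounts for `c_j = 3 c_{j-1} + 21`. The subtractions in `h₁` and `h₂` are not truncated
    -- because `i > c_j`.
    have b1 : eps ((h₁ : ℤ) - P.c j - 6) ≤ eps ((i : ℤ) - P.c (j + 1) + 2) :=
      eps_anti (by omega)
    have b2 : eps ((h₂ : ℤ) - P.c j - 6) ≤ eps ((i : ℤ) - P.c (j + 1) + 1) :=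
      eps_anti (by omega)
    have b3 : eps ((h₂ + 3 : ℕ) : ℤ) ≤ eps ((i : ℤ) - P.c (j + 1) + 3) := eps_anti (by omega)
    rw [eps_add] at b1 b2 b3
    have v1 : eps 1 = 1 / 2 := by norm_num [eps]
    have v2 : eps 2 = 1 / 4 := by norm_num [eps]
    have v3 : eps 3 = 1 / 8 := by norm_num [eps]
    rw [v2] at b1
    rw [v1] at b2
    rw [v3] at b3
    linarith

/-- Completeness of `Bdense`. -/
theorem mem_bdense_of_ncost_le {j i m : ℕ} {I J : Ivl} (hj : 1 ≤ j) (hw : P.w j = 2 ^ m)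
    (hd : ProcessDenseAt P acc D j) (hi : i ≤ P.L) (hI : I ∈ P.hIvls j) (hJ : J ∈ P.vIvls j i)
    (hz : z.length = 2 * P.n)
    (hsound : ∀ i ≤ P.L, ∀ I ∈ P.hIvls j, ∀ J ∈ P.vIvls j i, IsClose P acc D j I J i →
      ncost z I J ≤ eps ((i : ℤ) - P.c (j - 1) - 6))
    (hcomplete : ∀ i ≤ P.L, ∀ I ∈ P.hIvls j, ∀ J ∈ P.vIvls j i, ncost z I J ≤ eps i →
      IsClose P acc D j I J i)
    (hs : I ∉ D.sparse j i) (hcost : ncost z I J ≤ eps i) : J ∈ D.bdense j I i := by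
  rcases le_or_gt i (P.c j) with hic | hic
  · rwa [hd.bdense_eq_vIvls hi hic hI]
  · obtain ⟨I₀, hI₀, hX, hY⟩ := hd.bdense_eq hi hic hI hs
    rw [hY]
    obtain ⟨j, rfl⟩ := Nat.exists_eq_add_of_le' hj
    have hc : P.c (j + 1) = 3 * P.c j + 21 := rfl
    simp only [pivotX, pivotY, Finset.mem_filter, Nat.add_sub_cancel] at hX hsound ⊢
    set h₁ := i - P.c j - 7 with hh₁
    set h₂ := i - 2 * P.c j - 14 with hh₂
    obtain ⟨-, hXc⟩ := mem_enumerate_iff_isClose.1 hX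
    have hRv : roundDown J (h₂ + 3) ∈ P.vIvls (j + 1) h₂ := roundDown_mem_vIvls hJ
    refine ⟨hJ, mem_enumerate_iff_isClose.2 ⟨hRv, hcomplete h₂ (by omega) I₀ hI₀ _ hRv ?_⟩⟩
    have hIv := Params.hIvls_subset_vIvls hw h₁ hI
    have e1 := hsound h₁ (by omega) I₀ hI₀ I hIv hXc
    have e3 := (ncost_roundDown_le (z := z) (s := h₂ + 3) ((Params.width_vIvls hJ).trans hw)
      (Params.hi_vIvls hJ hz)).2
    have hIz := Params.hi_hIvls hI hz
    have hI₀z := Params.hi_hIvls hI₀ hz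
    have hRz := Params.hi_vIvls hRv hz
    have hJz := Params.hi_vIvls hJ hz
    have hwI : I.width = P.w (j + 1) := Params.width_hIvls hI
    have hwI₀ : I₀.width = P.w (j + 1) := Params.width_hIvls hI₀
    have hwR := Params.width_vIvls hRv
    have hwJ := Params.width_vIvls hJ
    have t1 := ncost_triangle hI₀z hIz hRz (hwI₀.trans hwI.symm)
    have t2 := ncost_triangle hIz hJz hRz (hwI.trans hwJ.symm)
    rw [ncost_comm hJz hRz (hwJ.trans hwR.symm)] at t2
    -- In units of `ε_{h₂}`, the way from the pivot to `I`, to `J` and to its rounding costs at most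
    -- 1/2 + 1/4 + 2/8 = 1. The first index bound is an equality, which explains the offset between
    -- `h₁` and `h₂`.
    have b1 : eps ((h₁ : ℤ) - P.c j - 6) ≤ eps ((h₂ : ℤ) + 1) := eps_anti (by omega)
    have b2 : eps i ≤ eps ((h₂ : ℤ) + 2) := eps_anti (by omega)
    have b3 : eps ((h₂ + 3 : ℕ) : ℤ) ≤ eps ((h₂ : ℤ) + 3) := eps_anti (by omega)
    rw [eps_add] at b1 b2 b3
    have v1 : eps 1 = 1 / 2 := by norm_num [eps]
    have v2 : eps 2 = 1 / 4 := by norm_num [eps]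
    have v3 : eps 3 = 1 / 8 := by norm_num [eps]
    rw [v1] at b1
    rw [v2] at b2
    rw [v3] at b3
    linarith

/-! ### The induction over the levels -/

theorem LevelCorrect.boxesR_certified_pred {j : ℕ} (hP : P.Valid) (hjk : j ≤ P.k) (hj : 1 ≤ j)
    (hz : z.length = 2 * P.n) (hprev : j ≠ 1 → LevelCorrect P z acc D (j - 1)) (hj1 : j ≠ 1) :
    ∀ b ∈ boxesR P D (j - 1), 0 < b.I.width ∧ b.Certified z := by
  obtain ⟨m, hm⟩ := hP.w_pow (j - 1) (by omega) (by omega)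
  exact fun b hb => ⟨boxesR_width_pos hm hb, (hprev hj1).boxesR_certified hm hz b hb⟩

/-- At one level, soundness and completeness of Enumerate follow from the previous level and the gap
subroutine, and those of `bdense` follow from Enumerate. The first level uses only the gap
subroutine, hence the guard in `hprev`. -/
theorem levelCorrect {ζ : ℝ} (hP : P.Valid) (hQ : 1 ≤ P.Q) (hz : z.length = 2 * P.n)
    (hrun : IsRun P acc D) (hSR : SuccessfulRandomization P ζ z acc D)
    (hacc : ∀ j, 1 ≤ j → j ≤ P.k → AcceptsCorrectly P z acc j) :
    ∀ j, 1 ≤ j → j ≤ P.k → LevelCorrect P z acc D j := by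
  intro j
  induction j with
  | zero => intro h; omega
  | succ j ih =>
    intro hj hjk
    obtain ⟨m, hw⟩ := hP.w_pow (j + 1) hj (by omega)
    obtain ⟨hpre, hd⟩ := hrun (j + 1) hj hjk
    have hprev : j + 1 ≠ 1 → LevelCorrect P z acc D (j + 1 - 1) :=
      fun h => ih (by omega) (by omega)
    have hsound : ∀ i ≤ P.L, ∀ I ∈ P.hIvls (j + 1), ∀ J ∈ P.vIvls (j + 1) i,
        IsClose P acc D (j + 1) I J i → ncost z I J ≤ eps ((i : ℤ) - P.c (j + 1 - 1) - 6) :=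
      fun i hi I hI J hJ => ncost_le_of_isClose hj hpre hi hI hJ hw hz hQ
        (LevelCorrect.boxesR_certified_pred hP hjk hj hz hprev) (hacc _ hj hjk)
    have hcomplete : ∀ i ≤ P.L, ∀ I ∈ P.hIvls (j + 1), ∀ J ∈ P.vIvls (j + 1) i,
        ncost z I J ≤ eps i → IsClose P acc D (j + 1) I J i :=
      fun i hi I hI J hJ => isClose_of_ncost_le hP hj hjk hpre hi hI hJ hz (hacc _ hj hjk) hSR hprev
    exact ⟨hcomplete,
      fun i hi I hI J hJ => ⟨hd.bdense_subset hi hI hJ,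
        ncost_le_of_mem_bdense hj hw hd hi hI hz hsound hJ⟩,
      fun i hi I hI hs J hJ hc =>
        mem_bdense_of_ncost_le hj hw hd hi hI hJ hz hsound hcomplete hs hc⟩

theorem LevelCorrect.mem_boxesQ {j i : ℕ} {I J : Ivl} (h : LevelCorrect P z acc D j) (hi : i ≤ P.L)
    (hI : I ∈ P.hIvls j) (hJ : J ∈ P.vIvls j i) (hs : I ∉ D.sparse j i)
    (hcost : ncost z I J ≤ eps i) :
    (⟨I, J, eps ((i : ℤ) - P.c j)⟩ : WBox) ∈ boxesQ P D j :=
  ⟨i, hi, I, hI, J, h.bdense_complete i hi I hI hs J hJ hcost, rfl⟩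

/-- Index `c_j` yields weight `ε_0 = 1`, and there every interval of the grid counts as dense. The
grid at `i ≤ c_j` is coarser, so `J` belongs to it; `c_j ≤ L` makes this index available. -/
theorem ProcessDenseAt.mem_boxesQ_one {j i m : ℕ} {I J : Ivl} (h : ProcessDenseAt P acc D j)
    (hw : P.w j = 2 ^ m) (hI : I ∈ P.hIvls j) (hJ : J ∈ P.vIvls j i) (hic : i ≤ P.c j)
    (hc : P.c j ≤ P.L) : (⟨I, J, 1⟩ : WBox) ∈ boxesQ P D j := by
  refine ⟨P.c j, hc, I, hI, J, ?_, ?_⟩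
  · rw [h.bdense_eq_vIvls hc le_rfl hI]
    exact Params.mem_vIvls_mono hw hic hJ
  · rw [sub_self, eps_zero]

end Level

/-- On a run with successful randomization the gap subroutine is correct at all levels. -/
theorem acceptsCorrectly {Ω : Type*} [MeasurableSpace Ω] {pr : MeasureTheory.Measure Ω}
    {ED : GapAlgorithm Ω α} {ζ : ℝ} {P : Params} (hED : GapCondition pr ED ζ P.Q) (hP : P.Valid)
    {z : List α} (hz : z.length = 2 * P.n) {ω : Ω} {D : RunData}
    (hSR : SuccessfulRandomization P ζ z (accepts P ED ω z) D) {j : ℕ} (hj : 1 ≤ j)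
    (hjk : j ≤ P.k) : AcceptsCorrectly P z (accepts P ED ω z) j := by
  obtain ⟨m, hw⟩ := hP.w_pow j hj (by omega)
  have hwr : (P.w j : ℝ) = 2 ^ m := by rw [hw]; push_cast; rfl
  refine ⟨fun i hi I hI J hJ hc => hSR.ed_accept j hj hjk i hi I hI J hJ ?_,
    fun i hi I hI J hJ hacc => ?_⟩
  · rw [hwr]
    exact (ncost_le_iff_editd (Params.hi_hIvls hI hz) (Params.hi_vIvls hJ hz)
      ((Params.width_hIvls hI).trans hw)).1 hc
  · rw [ncost_le_iff_editd (Params.hi_hIvls hI hz) (Params.hi_vIvls hJ hz)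
      ((Params.width_hIvls hI).trans hw), ← hwr]
    by_contra! hfar
    -- Above the threshold the gap condition gives rejection for every seed; below it, rejection is
    -- part of successful randomization.
    rcases lt_or_ge (eps i) ((P.w j : ℝ) ^ (-ζ)) with hlt | hge
    · exact hSR.ed_reject j hj hjk i hi I hI J hJ hlt hfar hacc
    · have hn : (1 : ℝ) < P.n := by
        have := hP.two_le_n (hj.trans hjk)
        exact_mod_cast this
      have hlen : ∀ K : Ivl, K.width = P.w j → K.hi ≤ z.length → (substr z K).length = P.w j := by
        intro K h1 h2
        rw [substr_eq_seg, length_seg h2, ← h1]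
        simp [Ivl.hi]
      have := (hED.2.2 (P.w j) ⟨m, hw⟩ (eps i) ⟨i, eps_natCast i⟩ hge ((P.n : ℝ) ^ (-12 : ℤ))
        (by positivity) (zpow_lt_one_of_neg₀ hn (by norm_num)) _ _
        (hlen I (Params.width_hIvls hI) (Params.hi_hIvls hI hz))
        (hlen J (Params.width_vIvls hJ) (Params.hi_vIvls hJ hz))).1 hfar ω
      unfold accepts at hacc
      rw [Params.width_hIvls hI, this] at hacc
      exact Bool.false_ne_true hacc

end EditDist

theorem theorem4 {α Ω : Type*} [MeasurableSpace Ω] (pr : MeasureTheory.Measure Ω)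
    [MeasureTheory.IsProbabilityMeasure pr] (ED : EditDist.GapAlgorithm Ω α)
    (ζ : ℝ) (P : EditDist.Params) (hED : EditDist.GapCondition pr ED ζ P.Q) (hP : P.Valid)
    (hθ : (P.n : ℝ) ^ (-ζ) ≤ P.θ)
    (x y : List α) (hx : x.length = P.n) (hy : y.length = P.n)
    (ω : Ω) (D : EditDist.RunData)
    (hrun : EditDist.IsRun P (EditDist.accepts P ED ω (x ++ y)) D)
    (hSR : EditDist.SuccessfulRandomization P ζ (x ++ y)
      (EditDist.accepts P ED ω (x ++ y)) D)
    (j : ℕ) (hj : 1 ≤ j) (hjk : j ≤ P.k) (i : ℕ) (hi : i ≤ P.L)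
    (I : EditDist.Ivl) (hI : I ∈ P.hIvls j) (J : EditDist.Ivl) (hJ : J ∈ P.vIvls j i)
    (Js : Finset EditDist.Ivl) (hJs : Js ⊆ P.vIvls j i) :
    EditDist.LevelProperties P (x ++ y) (EditDist.accepts P ED ω (x ++ y)) D j i I J Js := by
  have hz : (x ++ y).length = 2 * P.n := by rw [List.length_append, hx, hy, two_mul]
  have hacc := fun j hj hjk => EditDist.acceptsCorrectly hED hP hz hSR (j := j) hj hjk
  have hall := EditDist.levelCorrect hP hED.2.1 hz hrun hSR hacc
  have hlev := hall j hj hjk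
  have hprev : j ≠ 1 → EditDist.LevelCorrect P (x ++ y)
      (EditDist.accepts P ED ω (x ++ y)) D (j - 1) :=
    fun h => hall (j - 1) (by omega) (by omega)
  have hR := EditDist.LevelCorrect.boxesR_certified_pred hP hjk hj hz hprev
  obtain ⟨m, hw⟩ := hP.w_pow j hj (by omega)
  obtain ⟨hpre, hd⟩ := hrun j hj hjk
  refine ⟨EditDist.ncost_le_of_mem_bbelow hpre hi hI hw hz hR, fun hj2 hc => ?_,
    ⟨EditDist.mem_enumerate_iff, EditDist.isClose_iff.symm, EditDist.isFar_iff.symm⟩,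
    EditDist.ncost_le_of_isClose hj hpre hi hI hJ hw hz hED.2.1 hR (hacc j hj hjk),
    hlev.isClose_of_ncost_le i hi I hI J hJ, fun hs => ?_,
    fun h => (hlev.bdense_sound i hi I hI J h).2,
    fun hs => hlev.bdense_complete i hi I hI hs J hJ,
    hlev.boxesR_certified hw hz,
    fun hs hc => ⟨hlev.mem_boxesQ hi hI hJ hs hc, fun hcL => ?_⟩⟩
  · obtain ⟨j, rfl⟩ := Nat.exists_eq_add_of_le' hj
    exact EditDist.mem_bbelow_or_many_winners hP (by omega) (by omega) hpre hi hI hJ hz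
      (hprev (by omega)) hc
  · exact_mod_cast hSR.sparse_ok j hj hjk i hi I hs
  -- The minimum is 1 exactly when `i ≤ c_j`; then the box comes from index `c_j` and not from `i`.
  · rcases le_total i (P.c j) with hic | hic
    · rw [min_eq_left]
      · exact hd.mem_boxesQ_one hw hI hJ hic hcL
      · rw [← EditDist.eps_zero]; exact EditDist.eps_anti (by omega)
    · rw [min_eq_right]
      · exact hlev.mem_boxesQ hi hI hJ hs hc
      · rw [← EditDist.eps_zero]; exact EditDist.eps_anti (by omega)
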